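/- Let $d\ge 2$ and let $(\tau_e)_{e\in E(\mathbb Z^d)}$ be i.i.d. nonnegative, nondegenerate random weights on the nearest-neighbour edges of $\mathbb Z^d$, with $\tau_e\le C$ almost surely for some constant $C$ and $\mathbb P(\tau_e=0)<p_c(d)$, where $p_c(d)$ is the critical probability of Bernoulli bond percolation on $\mathbb Z^d$. For $\mathbf x,\mathbf y\in\mathbb Z^d$ let $T(\mathbf x,\mathbf y)=\inf_\gamma\sum_{e\in\gamma}\tau_e$, the infimum being over all lattice paths $\gamma$ from $\mathbf x$ to $\mathbf y$; for $\mathbf x,\mathbf y\in\mathbb R^d$ put $T(\mathbf x,\mathbf y)=T(\lfloor\mathbf x\rfloor,\lfloor\mathbf y\rfloor)$ with coordinatewise integer parts. Let $\mu(\mathbf x)=\lim_{N\to\infty}N^{-1}\mathbb E\,T(\mathbf 0,N\mathbf x)$ $(\mathbf x\in\mathbb R^d)$ be the time constant and $\mathbb B_d=\{\mathbf x\in\mathbb R^d:\mu(\mathbf x)\le 1\}$ the limit shape. Fix $\mathbf u\in\mathbb R^d$ with Euclidean norm $|\mathbf u|=1$, and let $H_{\mathbf u}$ be a tangent (i.e.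 supporting) hyperplane of $\mu(\mathbf u)\mathbb B_d$ at $\mathbf u$ (any one, if there are several). Let $\overline\chi\in(0,1)$ and assume lower tail concentration with exponent $\overline\chi$: there exist $\theta_0>0$ and $K_0$ such that for all integers $K\ge K_0$, all $a\in[\overline\chi,1]$ and all $\mathbf v\in H_{\mathbf u}$, $$\mathbb P\bigl(T(\mathbf 0,K\mathbf v)<K\mu(\mathbf u)-K^a\bigr)\le e^{-K^{\theta_0(a-\overline\chi)}}.$$ Then: (1) For every $\varepsilon>0$ there is $N_0$ such that for all integers $N\ge N_0$, all $a\in[\overline\chi+\varepsilon,1]$ and all $\mathbf v\in H_{\mathbf u}$, $$\mathbb P\bigl(T(\mathbf 0,N\mathbf v)<N\mu(\mathbf u)-N^a\bigr)\le \exp\Bigl(-N^{\frac{1-\varepsilon}{1-\overline\chi}(a-\overline\chi)}\Bigr).$$ (2) For every $\varepsilon>0$ there is $\zeta_0>0$ such that for all $\zeta\in(0,\zeta_0)$, $$\limsup_{N\to\infty}N^{-1}\log\mathbb P\bigl(T(\mathbf 0,N\mathbf u)<N\mu(\mathbf u)-\zeta N\bigr)\le-\zeta^{(1+\varepsilon)\frac1{1-\overline\chi}},$$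 where $N$ runs over the positive integers and $\log 0=-\infty$. -/

import Mathlib

open MeasureTheory ProbabilityTheory Filter

namespace FPP

/-- The nearest-neighbour graph on `ℤ^d`: two sites are adjacent when their `ℓ¹`-distance is `1`. -/
def lattice (d : ℕ) : SimpleGraph (Fin d → ℤ) where
  Adj x y := ∑ i, |x i - y i| = 1
  symm := ⟨fun x y h => by simpa only [abs_sub_comm] using h⟩
  loopless := ⟨fun x h => by simp at h⟩

/-- The edge set of `ℤ^d`, as a type. -/
abbrev Edge (d : ℕ) : Type := (lattice d).edgeSet

/-! ### Bernoulli bond percolation on `ℤ^d` -/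

/-- The open cluster of the origin when `S` is the set of open edges. -/
def cluster (d : ℕ) (S : Set (Sym2 (Fin d → ℤ))) : Set (Fin d → ℤ) :=
  {x | (SimpleGraph.fromEdgeSet (S ∩ (lattice d).edgeSet)).Reachable 0 x}

/-- The percolation probability `θ(p)`: every edge of `ℤ^d` is open with probability `p`,
independently; `θ(p)` is the probability that the open cluster of the origin is infinite. -/
noncomputable def percolationProb (d : ℕ) (p : unitInterval) : ENNReal :=
  setBernoulli (lattice d).edgeSet p {S | (cluster d S).Infinite}

/-- The critical probability `p_c(d) = sup {p ∈ [0,1] : θ(p) = 0}` of bond percolation. -/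
noncomputable def criticalProb (d : ℕ) : ℝ :=
  sSup {p : ℝ | ∃ hp : p ∈ unitInterval, percolationProb d ⟨p, hp⟩ = 0}

/-! ### First-passage percolation -/

/-- The passage time `∑_{e ∈ γ} t_e` of a lattice path `γ`. -/
def pathTime {d : ℕ} (t : Edge d → ℝ) :
    {x y : Fin d → ℤ} → (lattice d).Walk x y → ℝ
  | _, _, .nil => 0
  | _, _, .cons h γ => t ⟨s(_, _), (SimpleGraph.mem_edgeSet _).2 h⟩ + pathTime t γ

/-- The first-passage time between two sites. -/
noncomputable def siteTime {d : ℕ} (t : Edge d → ℝ) (x y : Fin d → ℤ) : ℝ :=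
  ⨅ γ : (lattice d).Walk x y, pathTime t γ

/-- The site `⌊x⌋ ∈ ℤ^d` with `x ∈ ⌊x⌋ + [0,1)^d`. -/
noncomputable def floorSite {d : ℕ} (x : EuclideanSpace ℝ (Fin d)) : Fin d → ℤ :=
  fun i => ⌊x i⌋

/-- The first-passage time `T(x, y) = T(⌊x⌋, ⌊y⌋)` between two points of `ℝ^d`. -/
noncomputable def T {d : ℕ} (t : Edge d → ℝ) (x y : EuclideanSpace ℝ (Fin d)) : ℝ :=
  siteTime t (floorSite x) (floorSite y)

variable {d : ℕ} {Ω : Type*} [MeasurableSpace Ω]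

/-- The standing conditions on the edge weights: independent, identically distributed,
nonnegative, nondegenerate, bounded, and with `P(τ_e = 0) < p_c(d)`. -/
structure IsWeightField (P : Measure Ω) (τ : Edge d → Ω → ℝ) : Prop where
  measurable : ∀ e, Measurable (τ e)
  indep : iIndepFun τ P
  identDistrib : ∀ e e', IdentDistrib (τ e) (τ e') P P
  nonneg : ∀ e, ∀ᵐ ω ∂P, 0 ≤ τ e ω
  nondegenerate : ∀ e, ∀ c : ℝ, ¬ ∀ᵐ ω ∂P, τ e ω = c
  bounded : ∃ C : ℝ, ∀ e, ∀ᵐ ω ∂P, τ e ω ≤ C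
  subcritical : ∀ e, P.real {ω | τ e ω = 0} < criticalProb d

/-- The time constant `μ(x) = lim_{N → ∞} E[T(0, N x)] / N`, for every `x ∈ ℝ^d`. For bounded
i.i.d. weights the limit exists for all real `x` (subadditivity up to a bounded error); it is the
a.s. and `L¹` limit of `T(0, N x) / N`, and is the continuous extension from `ℤ^d`. -/
noncomputable def timeConstant (P : Measure Ω) (τ : Edge d → Ω → ℝ)
    (x : EuclideanSpace ℝ (Fin d)) : ℝ :=
  limUnder atTop fun N : ℕ => (∫ ω, T (fun e => τ e ω) 0 ((N : ℝ) • x) ∂P) / (N : ℝ)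

/-- The limit shape `{x ∈ ℝ^d : μ(x) ≤ 1}`. -/
def limitShape (P : Measure Ω) (τ : Edge d → Ω → ℝ) : Set (EuclideanSpace ℝ (Fin d)) :=
  {x | timeConstant P τ x ≤ 1}

/-- `H` is a tangent (supporting) hyperplane at `u` of the dilated limit shape `μ(u) • 𝔹`, that is,
`H` is an affine hyperplane through `u` that has `μ(u) • 𝔹` on one side. -/
def IsTangentHyperplane (P : Measure Ω) (τ : Edge d → Ω → ℝ) (u : EuclideanSpace ℝ (Fin d))
    (H : Set (EuclideanSpace ℝ (Fin d))) : Prop :=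
  ∃ n : EuclideanSpace ℝ (Fin d), n ≠ 0 ∧
    (∀ x ∈ limitShape P τ, inner ℝ n (timeConstant P τ u • x) ≤ inner ℝ n u) ∧
    H = {v | inner ℝ n v = inner ℝ n u}

/-- Lower tail concentration with exponent `χ`, uniformly over endpoints on the hyperplane `H`. -/
def LowerTailConcentration (P : Measure Ω) (τ : Edge d → Ω → ℝ) (u : EuclideanSpace ℝ (Fin d))
    (H : Set (EuclideanSpace ℝ (Fin d))) (χ : ℝ) : Prop :=
  ∃ θ₀ : ℝ, 0 < θ₀ ∧ ∃ K₀ : ℕ, ∀ K : ℕ, K₀ ≤ K → ∀ a ∈ Set.Icc χ 1, ∀ v ∈ H,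
    P.real {ω | T (fun e => τ e ω) 0 ((K : ℝ) • v)
        < (K : ℝ) * timeConstant P τ u - (K : ℝ) ^ a}
      ≤ Real.exp (-((K : ℝ) ^ (θ₀ * (a - χ))))

end FPP

namespace FPP

open scoped ENNReal

/-! ### A disjoint-occurrence inequality for products of independent weights -/

/-! The object to control is the Laplace transform `psi`, ψ_λ(z) = E exp(-λ T(0, z)). Let the height
be the linear functional that equals 1 on the tangent hyperplane. A path from the origin to a site x
of height at least K cannot jump over the slab of heights [K, K + b), b exceeding the largest height
change along one edge. Cut a self-avoiding path at a site z of that slab: the two pieces use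
disjoint edges. Giving the second piece an independent copy of the weights can only increase the
expected best product of exponential weights (`lintegral_iSup_prod_mul_prod_le`, in the spirit of
the van den Berg–Kesten inequality). Hence ψ_λ(x) is at most the sum over the slab of ψ_λ(z) ψ_λ(x -
z) (`IsClampedField.psi_le_tsum`). The sum converges because a lattice symmetry moves a remote site
of the slab to one of large height, where ψ_λ is tiny.

Suppose the lower tail decays exponentially beyond fluctuations of order height^κ (`TailBound`). At
λ = c K^(-κ) each slab then costs the expected factor exp(-λ M K) times a power of K. Iterating over
slabs and applying Chernoff bounds the probability that T(0, x) < M h - s, with h the height of x,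
by exp(-c K^(-κ) s + q (h/K + 2) log K), for every large K (`ScaleBound`).

Concentration first gives only some κ < 1 (`StretchedTailBound.tailBound`). Using concentration
itself for small s, and `ScaleBound` at K = h^(1-δ) for large s, lowers κ (`ScaleBound.tailBound`).
The gap κ - χ shrinks geometrically under repetition, so `ScaleBound` holds for every κ in (χ, 1)
(`StretchedTailBound.scaleBound`).

It remains to optimise K. Balancing K^(-χ) s against N/K gives K = (N/s)^(1/(1-χ)), and the exponent
is then N/K: this is N^((a-χ)/(1-χ)) for s = N^a, and N ζ^(1/(1-χ)) for s = ζN. Taking K slightly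
larger than this absorbs the logarithm and the excess κ - χ, at the price of ε
(`moderate_deviation`, `large_deviation`). -/

lemma measurable_finset_iSup {α β : Type*} [MeasurableSpace α] {s : Finset β}
    {f : β → α → ℝ≥0∞} (hf : ∀ b, Measurable (f b)) : Measurable fun a => ⨆ b ∈ s, f b a :=
  Measurable.biSup (s : Set β) s.countable_toSet fun b _ => hf b

section Disjoint

variable {ι : Type*} [DecidableEq ι]

/-- The weight of a pair of index sets when the second set reads the second copy of the weights
at the indices of `F`, and the first copy elsewhere. -/
noncomputable def mixedWeight (F : Finset ι) (q : Finset ι × Finset ι) (p : ι → ℝ≥0∞ × ℝ≥0∞) :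
    ℝ≥0∞ :=
  (∏ i ∈ q.1, (p i).1) * ∏ i ∈ q.2, if i ∈ F then (p i).2 else (p i).1

lemma measurable_mixedWeight (F : Finset ι) (q : Finset ι × Finset ι) :
    Measurable (mixedWeight F q) := by
  unfold mixedWeight
  refine Measurable.mul (Finset.measurable_prod _ fun i _ => by fun_prop)
    (Finset.measurable_prod _ fun i _ => ?_)
  split_ifs <;> fun_prop

/-- Exchange the two copies of the weight at the index `e`. -/
def swapAt (e : ι) (p : ι → ℝ≥0∞ × ℝ≥0∞) : ι → ℝ≥0∞ × ℝ≥0∞ :=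
  fun i => if i = e then (p i).swap else p i

lemma measurePreserving_swapAt [Fintype ι] (ν : ι → Measure ℝ≥0∞)
    [∀ i, IsProbabilityMeasure (ν i)] (e : ι) :
    MeasurePreserving (swapAt e) (Measure.pi fun i => (ν i).prod (ν i))
      (Measure.pi fun i => (ν i).prod (ν i)) := by
  refine measurePreserving_pi (f := fun i (x : ℝ≥0∞ × ℝ≥0∞) => if i = e then x.swap else x)
    (fun i => (ν i).prod (ν i)) (fun i => (ν i).prod (ν i)) fun i => ?_
  by_cases h : i = e
  · simpa [h] using Measure.measurePreserving_swap (μ := ν e) (ν := ν e)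
  · simp only [h, if_false]
    exact MeasurePreserving.id _

lemma mixedWeight_swapAt {F : Finset ι} {q : Finset ι × Finset ι} {e : ι} (h1 : e ∉ q.1)
    (h2 : e ∉ q.2) (p : ι → ℝ≥0∞ × ℝ≥0∞) :
    mixedWeight F q (swapAt e p) = mixedWeight F q p := by
  have h (i) (s : Finset ι) (hs : e ∉ s) (hi : i ∈ s) : swapAt e p i = p i := by
    rw [swapAt, if_neg]; rintro rfl; exact hs hi
  unfold mixedWeight
  congr 1
  · exact Finset.prod_congr rfl fun i hi => by rw [h i _ h1 hi]
  · exact Finset.prod_congr rfl fun i hi => by rw [h i _ h2 hi]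

lemma mixedWeight_insert {F : Finset ι} {q : Finset ι × Finset ι} {e : ι}
    (h2 : e ∉ q.2) (p : ι → ℝ≥0∞ × ℝ≥0∞) :
    mixedWeight (insert e F) q p = mixedWeight F q p := by
  unfold mixedWeight
  congr 1
  refine Finset.prod_congr rfl fun i hi => ?_
  have : i ≠ e := by rintro rfl; exact h2 hi
  simp [this]

lemma mixedWeight_of_mem_left {F : Finset ι} {q : Finset ι × Finset ι} {e : ι}
    (h1 : e ∈ q.1) (p : ι → ℝ≥0∞ × ℝ≥0∞) :
    mixedWeight F q p = mixedWeight F (q.1.erase e, q.2) p * (p e).1 := by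
  simp only [mixedWeight]
  rw [← Finset.prod_erase_mul _ _ h1]
  ring

lemma mixedWeight_of_mem_right {F : Finset ι} {q : Finset ι × Finset ι} {e : ι}
    (h2 : e ∈ q.2) (p : ι → ℝ≥0∞ × ℝ≥0∞) :
    mixedWeight F q p =
      mixedWeight F (q.1, q.2.erase e) p * if e ∈ F then (p e).2 else (p e).1 := by
  simp only [mixedWeight]
  rw [← Finset.prod_erase_mul _ _ h2]
  ring

/-- Given everything away from e, the supremum has the form max(A, max(B, C) w) before decoupling
and at least max(A, B w, C w') after it, with w, w' exchangeable. Whichever of B and C is larger can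
be matched with its own copy of the weight. -/
lemma lintegral_mixedWeight_le_insert [Fintype ι] (ν : ι → Measure ℝ≥0∞)
    [∀ i, IsProbabilityMeasure (ν i)] (I : Finset (Finset ι × Finset ι))
    (hI : ∀ q ∈ I, Disjoint q.1 q.2) {F : Finset ι} {e : ι} (he : e ∉ F) :
    ∫⁻ p, (⨆ q ∈ I, mixedWeight F q p) ∂(Measure.pi fun i => (ν i).prod (ν i)) ≤
      ∫⁻ p, (⨆ q ∈ I, mixedWeight (insert e F) q p)
        ∂(Measure.pi fun i => (ν i).prod (ν i)) := by
  classical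
  set π := Measure.pi fun i => (ν i).prod (ν i)
  -- `A` collects the pairs avoiding e; `B` and `C` those using e in the first or the second set,
  -- with the factor at e removed. None of the three reads either copy at e.
  set A : (ι → ℝ≥0∞ × ℝ≥0∞) → ℝ≥0∞ := fun p =>
    ⨆ q ∈ I.filter (fun q => e ∉ q.1 ∧ e ∉ q.2), mixedWeight F q p with hA
  set B : (ι → ℝ≥0∞ × ℝ≥0∞) → ℝ≥0∞ := fun p =>
    ⨆ q ∈ I.filter (fun q => e ∈ q.1), mixedWeight F (q.1.erase e, q.2) p with hB
  set C : (ι → ℝ≥0∞ × ℝ≥0∞) → ℝ≥0∞ := fun p =>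
    ⨆ q ∈ I.filter (fun q => e ∈ q.2), mixedWeight F (q.1, q.2.erase e) p with hC
  have mA : Measurable A := measurable_finset_iSup fun q => measurable_mixedWeight F q
  have mB : Measurable B := measurable_finset_iSup fun q => measurable_mixedWeight F _
  have mC : Measurable C := measurable_finset_iSup fun q => measurable_mixedWeight F _
  have hdis (q) (hq : q ∈ I) : e ∈ q.1 → e ∉ q.2 := fun h1 h2 =>
    (Finset.disjoint_left.1 (hI q hq)) h1 h2
  have sA (p) : A (swapAt e p) = A p := by
    simp only [hA]
    refine iSup_congr fun q => iSup_congr fun hq => ?_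
    rw [Finset.mem_filter] at hq
    exact mixedWeight_swapAt hq.2.1 hq.2.2 p
  have sB (p) : B (swapAt e p) = B p := by
    simp only [hB]
    refine iSup_congr fun q => iSup_congr fun hq => ?_
    rw [Finset.mem_filter] at hq
    exact mixedWeight_swapAt (q := (q.1.erase e, q.2)) (Finset.notMem_erase e q.1) 
      (hdis q hq.1 hq.2) p
  have sC (p) : C (swapAt e p) = C p := by
    simp only [hC]
    refine iSup_congr fun q => iSup_congr fun hq => ?_
    rw [Finset.mem_filter] at hq
    exact mixedWeight_swapAt (q := (q.1, q.2.erase e)) (fun h => hdis q hq.1 h hq.2) 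
      (Finset.notMem_erase e q.2) p
  have up (p) : (⨆ q ∈ I, mixedWeight F q p) ≤ max (A p) (max (B p) (C p) * (p e).1) := by
    refine iSup₂_le fun q hq => ?_
    by_cases h1 : e ∈ q.1
    · rw [mixedWeight_of_mem_left h1]
      refine le_trans ?_ (le_max_right _ _)
      gcongr
      refine le_trans ?_ (le_max_left _ _)
      exact le_iSup₂_of_le q (Finset.mem_filter.2 ⟨hq, h1⟩) le_rfl
    by_cases h2 : e ∈ q.2
    · rw [mixedWeight_of_mem_right h2, if_neg he]
      refine le_trans ?_ (le_max_right _ _)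
      gcongr
      refine le_trans ?_ (le_max_right _ _)
      exact le_iSup₂_of_le q (Finset.mem_filter.2 ⟨hq, h2⟩) le_rfl
    · refine le_trans ?_ (le_max_left _ _)
      exact le_iSup₂_of_le q (Finset.mem_filter.2 ⟨hq, h1, h2⟩) le_rfl
  have low (p) : max (A p) (max (B p * (p e).1) (C p * (p e).2)) ≤
      ⨆ q ∈ I, mixedWeight (insert e F) q p := by
    refine max_le ?_ (max_le ?_ ?_)
    · refine iSup₂_le fun q hq => ?_
      rw [Finset.mem_filter] at hq
      refine le_iSup₂_of_le q hq.1 ?_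
      rw [mixedWeight_insert hq.2.2]
    · simp only [hB, ENNReal.iSup_mul]
      refine iSup₂_le fun q hq => ?_
      rw [Finset.mem_filter] at hq
      refine le_iSup₂_of_le q hq.1 ?_
      rw [mixedWeight_insert (hdis q hq.1 hq.2), ← mixedWeight_of_mem_left hq.2]
    · simp only [hC, ENNReal.iSup_mul]
      refine iSup₂_le fun q hq => ?_
      rw [Finset.mem_filter] at hq
      refine le_iSup₂_of_le q hq.1 ?_
      rw [mixedWeight_of_mem_right hq.2, if_pos (Finset.mem_insert_self _ _),
        mixedWeight_insert (by simp)]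
  have me1 : Measurable fun p : ι → ℝ≥0∞ × ℝ≥0∞ => (p e).1 := by fun_prop
  have me2 : Measurable fun p : ι → ℝ≥0∞ × ℝ≥0∞ => (p e).2 := by fun_prop
  have mE : MeasurableSet {p | C p ≤ B p} := measurableSet_le mC mB
  set E := {p | C p ≤ B p}
  calc _ ≤ ∫⁻ p, max (A p) (max (B p) (C p) * (p e).1) ∂π := lintegral_mono up
    _ = ∫⁻ p in E, max (A p) (max (B p) (C p) * (p e).1) ∂π +
        ∫⁻ p in Eᶜ, max (A p) (max (B p) (C p) * (p e).1) ∂π :=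
          (lintegral_add_compl _ mE).symm
    _ ≤ ∫⁻ p in E, (⨆ q ∈ I, mixedWeight (insert e F) q p) ∂π +
        ∫⁻ p in Eᶜ, (⨆ q ∈ I, mixedWeight (insert e F) q p) ∂π := by
          refine add_le_add (setLIntegral_mono' mE fun p hp => ?_) ?_
          · refine le_trans ?_ (low p)
            rw [max_eq_left (show C p ≤ B p from hp)]
            exact max_le_max le_rfl (le_max_left _ _)
          -- Where `C` wins, the factor should be the second copy at e. Swapping the copies
          -- preserves the measure, the event and `A`, `B`, `C`.
          · have key : ∫⁻ p in Eᶜ, max (A p) (max (B p) (C p) * (p e).1) ∂π =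
                ∫⁻ p in Eᶜ, max (A p) (C p * (p e).2) ∂π := by
              rw [← lintegral_indicator mE.compl, ← lintegral_indicator mE.compl]
              have hm : Measurable (Eᶜ.indicator fun p => max (A p) (C p * (p e).2)) :=
                (mA.max (mC.mul me2)).indicator mE.compl
              rw [← (measurePreserving_swapAt ν e).lintegral_comp hm]
              refine lintegral_congr fun p => ?_
              by_cases hp : p ∈ E
              · have hp' : swapAt e p ∈ E := by
                  change C _ ≤ B _; rw [sB, sC]; exact hp
                simp [hp, hp']
              · have hp' : swapAt e p ∉ E := by
                  change ¬ C _ ≤ B _; rw [sB, sC]; exact hp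
                rw [Set.indicator_of_mem hp, Set.indicator_of_mem hp', sA, sC,
                  max_eq_right (show B p ≤ C p from le_of_not_ge hp)]
                simp [swapAt]
            rw [key]
            refine lintegral_mono fun p => le_trans ?_ (low p)
            exact max_le_max le_rfl (le_max_right _ _)
    _ = _ := lintegral_add_compl _ mE

/-- If each pair of index sets in a finite family is disjoint, then decoupling the two members of
the pairs can only increase the expected best product of independent weights. -/
theorem lintegral_iSup_prod_mul_prod_le [Fintype ι] (ν : ι → Measure ℝ≥0∞)
    [∀ i, IsProbabilityMeasure (ν i)] (I : Finset (Finset ι × Finset ι))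
    (hI : ∀ q ∈ I, Disjoint q.1 q.2) :
    ∫⁻ w, (⨆ q ∈ I, (∏ i ∈ q.1, w i) * ∏ i ∈ q.2, w i) ∂(Measure.pi ν) ≤
      ∫⁻ w, (⨆ q ∈ I, (∏ i ∈ q.1, w.1 i) * ∏ i ∈ q.2, w.2 i)
        ∂((Measure.pi ν).prod (Measure.pi ν)) := by
  set π := Measure.pi fun i => (ν i).prod (ν i)
  -- At `∅` both products read the first copy; at `univ` the second product reads only the second
  -- copy. The indices are passed over one at a time.
  have key (F : Finset ι) : ∫⁻ p, (⨆ q ∈ I, mixedWeight ∅ q p) ∂π ≤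
      ∫⁻ p, (⨆ q ∈ I, mixedWeight F q p) ∂π := by
    induction F using Finset.induction_on with
    | empty => exact le_rfl
    | insert e F he ih => exact ih.trans (lintegral_mixedWeight_le_insert ν I hI he)
  have mp := measurePreserving_arrowProdEquivProdArrow ℝ≥0∞ ℝ≥0∞ ι ν ν
  have m2 : Measurable fun w : (ι → ℝ≥0∞) × (ι → ℝ≥0∞) =>
      ⨆ q ∈ I, (∏ i ∈ q.1, w.1 i) * ∏ i ∈ q.2, w.2 i :=
    measurable_finset_iSup fun q => by fun_prop
  have m1 : Measurable fun w : ι → ℝ≥0∞ => ⨆ q ∈ I, (∏ i ∈ q.1, w i) * ∏ i ∈ q.2, w i :=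
    measurable_finset_iSup fun q => by fun_prop
  have e1 : ∫⁻ w, (⨆ q ∈ I, (∏ i ∈ q.1, w i) * ∏ i ∈ q.2, w i) ∂(Measure.pi ν) =
      ∫⁻ p, (⨆ q ∈ I, mixedWeight ∅ q p) ∂π := by
    rw [← (measurePreserving_fst.comp mp).lintegral_comp m1]
    simp [mixedWeight, MeasurableEquiv.arrowProdEquivProdArrow, Equiv.arrowProdEquivProdArrow, π]
  rw [e1, ← mp.lintegral_comp m2]
  refine (key Finset.univ).trans (le_of_eq ?_)
  simp [mixedWeight, MeasurableEquiv.arrowProdEquivProdArrow, Equiv.arrowProdEquivProdArrow, π]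

end Disjoint

section Disjoint

variable {ι : Type*} [DecidableEq ι] {Ω : Type*} [MeasurableSpace Ω]

/-- Decoupling for independent random variables indexed by an arbitrary type. -/
theorem lintegral_iSup_prod_mul_prod_le_of_iIndepFun (P : Measure Ω) [IsProbabilityMeasure P]
    {w : ι → Ω → ℝ≥0∞} (hm : ∀ i, Measurable (w i)) (hw : iIndepFun w P)
    (I : Finset (Finset ι × Finset ι)) (hI : ∀ q ∈ I, Disjoint q.1 q.2) :
    ∫⁻ ω, (⨆ q ∈ I, (∏ i ∈ q.1, w i ω) * ∏ i ∈ q.2, w i ω) ∂P ≤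
      ∫⁻ ω, (⨆ q ∈ I, (∏ i ∈ q.1, w i ω.1) * ∏ i ∈ q.2, w i ω.2) ∂(P.prod P) := by
  classical
  set F : Finset ι := I.biUnion fun q => q.1 ∪ q.2
  have hF (q) (hq : q ∈ I) : q.1 ⊆ F ∧ q.2 ⊆ F := by
    have : q.1 ∪ q.2 ⊆ F := Finset.subset_biUnion_of_mem (fun q : Finset ι × Finset ι => q.1 ∪ q.2) hq
    exact ⟨Finset.subset_union_left.trans this, Finset.subset_union_right.trans this⟩
  have hmW : Measurable fun ω (i : F) => w i ω := by fun_prop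
  have hlaw : P.map (fun ω (i : F) => w i ω) = Measure.pi fun i : F => P.map (w i) :=
    (iIndepFun_iff_map_fun_eq_pi_map (fun i : F => (hm i).aemeasurable)).1
      (hw.precomp Subtype.val_injective)
  have hp : ∀ i : F, IsProbabilityMeasure (P.map (w i)) := fun i =>
    Measure.isProbabilityMeasure_map (hm i).aemeasurable
  set J : Finset (Finset F × Finset F) :=
    I.image fun q => (q.1.subtype (· ∈ F), q.2.subtype (· ∈ F)) with hJ
  have key := lintegral_iSup_prod_mul_prod_le (fun i : F => P.map (w i)) J (by
    simp only [hJ, Finset.mem_image]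
    rintro _ ⟨q, hq, rfl⟩
    rw [Finset.disjoint_left]
    intro a h1 h2
    rw [Finset.mem_subtype] at h1 h2
    exact Finset.disjoint_left.1 (hI q hq) h1 h2)
  rw [← hlaw, Measure.map_prod_map _ _ hmW hmW, lintegral_map _ (hmW.prodMap hmW),
    lintegral_map _ hmW] at key
  · simp only [hJ, Finset.iSup_finset_image, Prod.map_fst, Prod.map_snd] at key
    have hs (v : ι → ℝ≥0∞) (s : Finset ι) (h : s ⊆ F) :
        ∏ i ∈ s.subtype (· ∈ F), v i = ∏ i ∈ s, v i :=
      Finset.prod_subtype_of_mem v fun x hx => h hx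
    refine le_trans (le_of_eq ?_) (key.trans (le_of_eq ?_))
    · refine lintegral_congr fun ω => iSup_congr fun q => iSup_congr fun hq => ?_
      rw [hs (fun i => w i ω) _ (hF q hq).1, hs (fun i => w i ω) _ (hF q hq).2]
    · refine lintegral_congr fun ω => iSup_congr fun q => iSup_congr fun hq => ?_
      rw [hs (fun i => w i ω.1) _ (hF q hq).1, hs (fun i => w i ω.2) _ (hF q hq).2]
  · exact measurable_finset_iSup fun q => by fun_prop
  · exact measurable_finset_iSup fun q => by fun_prop

end Disjoint

/-! ### Lattice paths -/

section Paths

variable {d : ℕ}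

/-- The list of edges of a lattice path, as elements of `Edge d`. -/
def edgeList : {x y : Fin d → ℤ} → (lattice d).Walk x y → List (Edge d)
  | _, _, .nil => []
  | _, _, .cons h γ => ⟨s(_, _), (SimpleGraph.mem_edgeSet _).2 h⟩ :: edgeList γ

lemma edgeList_map_val {x y : Fin d → ℤ} (γ : (lattice d).Walk x y) :
    (edgeList γ).map Subtype.val = γ.edges := by
  induction γ with
  | nil => rfl
  | cons h γ ih => simp [edgeList, ih]

lemma pathTime_eq_sum_edgeList (t : Edge d → ℝ) {x y : Fin d → ℤ} (γ : (lattice d).Walk x y) :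
    pathTime t γ = ((edgeList γ).map t).sum := by
  induction γ with
  | nil => rfl
  | cons h γ ih => simp [edgeList, pathTime, ih]

lemma edgeList_append {x y z : Fin d → ℤ} (γ : (lattice d).Walk x y)
    (γ' : (lattice d).Walk y z) : edgeList (γ.append γ') = edgeList γ ++ edgeList γ' := by
  induction γ with
  | nil => rfl
  | cons h γ ih => simp [edgeList, ih]

/-- The finite set of edges of a lattice path. -/
def edgeFinset {x y : Fin d → ℤ} (γ : (lattice d).Walk x y) : Finset (Edge d) :=
  (edgeList γ).toFinset

lemma edgeList_nodup {x y : Fin d → ℤ} {γ : (lattice d).Walk x y} (hγ : γ.IsPath) :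
    (edgeList γ).Nodup :=
  List.Nodup.of_map Subtype.val (by rw [edgeList_map_val]; exact hγ.isTrail.edges_nodup)

lemma pathTime_eq_sum {x y : Fin d → ℤ} {γ : (lattice d).Walk x y} (hγ : γ.IsPath)
    (t : Edge d → ℝ) : pathTime t γ = ∑ e ∈ edgeFinset γ, t e := by
  rw [pathTime_eq_sum_edgeList, edgeFinset, List.sum_toFinset _ (edgeList_nodup hγ)]

lemma pathTime_nonneg {t : Edge d → ℝ} (ht : ∀ e, 0 ≤ t e) {x y : Fin d → ℤ}
    (γ : (lattice d).Walk x y) : 0 ≤ pathTime t γ := by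
  induction γ with
  | nil => exact le_rfl
  | cons h γ ih => exact add_nonneg (ht _) ih

lemma pathTime_append (t : Edge d → ℝ) {x y z : Fin d → ℤ} (γ : (lattice d).Walk x y)
    (γ' : (lattice d).Walk y z) : pathTime t (γ.append γ') = pathTime t γ + pathTime t γ' := by
  simp [pathTime_eq_sum_edgeList, edgeList_append]

lemma pathTime_le_length_mul {t : Edge d → ℝ} {C : ℝ} (ht : ∀ e, t e ≤ C) {x y : Fin d → ℤ}
    (γ : (lattice d).Walk x y) : pathTime t γ ≤ γ.length * C := by
  induction γ with
  | nil => simp [pathTime]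
  | cons h γ ih =>
    simp only [pathTime, SimpleGraph.Walk.length_cons, Nat.cast_add, Nat.cast_one]
    linarith [ht ⟨s(_, _), (SimpleGraph.mem_edgeSet _).2 h⟩]

/-- Erasing loops only deletes edges, and weights are nonnegative. So only self-avoiding paths
matter, and these use each edge at most once. -/
lemma pathTime_bypass_le {t : Edge d → ℝ} (ht : ∀ e, 0 ≤ t e) {x y : Fin d → ℤ}
    (γ : (lattice d).Walk x y) : pathTime t γ.bypass ≤ pathTime t γ := by
  have h : (edgeList γ.bypass).Sublist (edgeList γ) := by
    have := γ.edges_bypass_sublist_edges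
    rw [← edgeList_map_val, ← edgeList_map_val] at this
    obtain ⟨l, hl, hl'⟩ := List.sublist_map_iff.1 this
    rwa [← List.map_injective_iff.2 Subtype.val_injective hl'] at hl
  rw [pathTime_eq_sum_edgeList, pathTime_eq_sum_edgeList]
  exact (h.map t).sum_le_sum (by simp only [List.mem_map]; rintro _ ⟨e, -, rfl⟩; exact ht e)

instance countable_walk (x y : Fin d → ℤ) : Countable ((lattice d).Walk x y) :=
  Function.Injective.countable (f := fun γ : (lattice d).Walk x y => γ.support)
    fun _ _ h => SimpleGraph.Walk.ext_support h

lemma exists_walk_length_le (n : ℕ) (x y : Fin d → ℤ) (h : ∑ i, |x i - y i| = n) :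
    ∃ γ : (lattice d).Walk x y, γ.length ≤ n := by
  induction n generalizing x with
  | zero =>
    have : x = y := by
      funext i
      have := (Finset.sum_eq_zero_iff_of_nonneg (fun i _ => abs_nonneg (x i - y i))).1
        (by simpa using h) i (Finset.mem_univ i)
      exact sub_eq_zero.1 (abs_eq_zero.1 this)
    subst this
    exact ⟨.nil, le_rfl⟩
  | succ n ih =>
    obtain ⟨i, hi⟩ : ∃ i, x i ≠ y i := by
      by_contra! hc
      simp [hc] at h
      omega
    obtain ⟨s, hs1, hs2⟩ : ∃ s : ℤ, |s| = 1 ∧ |x i + s - y i| = |x i - y i| - 1 := by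
      rcases lt_or_gt_of_ne hi with h | h
      · refine ⟨1, rfl, ?_⟩
        rw [abs_of_nonpos (by omega), abs_of_neg (by omega)]; ring
      · refine ⟨-1, rfl, ?_⟩
        rw [abs_of_nonneg (by omega), abs_of_pos (by omega)]; ring
    have hadj : (lattice d).Adj x (Function.update x i (x i + s)) := by
      change ∑ j, |x j - Function.update x i (x i + s) j| = 1
      rw [Finset.sum_eq_single i]
      · simp [hs1]
      · intro j _ hj; simp [hj]
      · simp
    obtain ⟨γ, hγ⟩ := ih (Function.update x i (x i + s)) (by
      rw [← Finset.add_sum_erase _ _ (Finset.mem_univ i)] at h ⊢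
      rw [Finset.sum_congr rfl (g := fun j => |x j - y j|)]
      · simp only [Function.update_self, hs2]
        push_cast at h; linarith
      · intro j hj
        rw [Function.update_of_ne (Finset.ne_of_mem_erase hj)])
    exact ⟨.cons hadj γ, by simpa using hγ⟩

instance nonempty_walk (x y : Fin d → ℤ) : Nonempty ((lattice d).Walk x y) := by
  obtain ⟨n, hn⟩ := Int.eq_ofNat_of_zero_le
    (Finset.sum_nonneg fun i (_ : i ∈ Finset.univ) => abs_nonneg (x i - y i))
  exact ⟨(exists_walk_length_le n x y hn).choose⟩

lemma bddBelow_pathTime {t : Edge d → ℝ} (ht : ∀ e, 0 ≤ t e) (x y : Fin d → ℤ) :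
    BddBelow (Set.range fun γ : (lattice d).Walk x y => pathTime t γ) :=
  ⟨0, by rintro _ ⟨γ, rfl⟩; exact pathTime_nonneg ht γ⟩

lemma siteTime_le_pathTime {t : Edge d → ℝ} (ht : ∀ e, 0 ≤ t e) {x y : Fin d → ℤ}
    (γ : (lattice d).Walk x y) : siteTime t x y ≤ pathTime t γ :=
  ciInf_le (bddBelow_pathTime ht x y) γ

lemma siteTime_nonneg {t : Edge d → ℝ} (ht : ∀ e, 0 ≤ t e) (x y : Fin d → ℤ) :
    0 ≤ siteTime t x y :=
  le_ciInf fun γ => pathTime_nonneg ht γ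

lemma siteTime_triangle {t : Edge d → ℝ} (ht : ∀ e, 0 ≤ t e) (x y z : Fin d → ℤ) :
    siteTime t x z ≤ siteTime t x y + siteTime t y z := by
  refine le_ciInf_add_ciInf fun γ γ' => ?_
  rw [← pathTime_append]
  exact siteTime_le_pathTime ht _

lemma siteTime_le {t : Edge d → ℝ} (ht : ∀ e, 0 ≤ t e) {C : ℝ} (hC : 0 ≤ C) (htC : ∀ e, t e ≤ C)
    (x y : Fin d → ℤ) : siteTime t x y ≤ (∑ i, |x i - y i| : ℤ) * C := by
  obtain ⟨n, hn⟩ := Int.eq_ofNat_of_zero_le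
    (Finset.sum_nonneg fun i (_ : i ∈ Finset.univ) => abs_nonneg (x i - y i))
  obtain ⟨γ, hγ⟩ := exists_walk_length_le n x y hn
  rw [hn]
  refine (siteTime_le_pathTime ht γ).trans ((pathTime_le_length_mul htC γ).trans ?_)
  have : (γ.length : ℝ) ≤ n := by exact_mod_cast hγ
  simp only [Int.cast_natCast]
  gcongr

lemma siteTime_self {t : Edge d → ℝ} (ht : ∀ e, 0 ≤ t e) (x : Fin d → ℤ) :
    siteTime t x x = 0 :=
  le_antisymm (siteTime_le_pathTime ht .nil) (siteTime_nonneg ht x x)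

/-- The exponential weight of the passage time, as a supremum over self-avoiding paths. -/
lemma ofReal_exp_siteTime {t : Edge d → ℝ} (ht : ∀ e, 0 ≤ t e) {l : ℝ} (hl : 0 ≤ l)
    (x y : Fin d → ℤ) :
    ENNReal.ofReal (Real.exp (-l * siteTime t x y)) =
      ⨆ γ : {γ : (lattice d).Walk x y // γ.IsPath},
        ∏ e ∈ edgeFinset γ.1, ENNReal.ofReal (Real.exp (-l * t e)) := by
  have hpath (γ : {γ : (lattice d).Walk x y // γ.IsPath}) :
      ∏ e ∈ edgeFinset γ.1, ENNReal.ofReal (Real.exp (-l * t e)) =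
        ENNReal.ofReal (Real.exp (-l * pathTime t γ.1)) := by
    rw [pathTime_eq_sum γ.2, Finset.mul_sum, Real.exp_sum,
      ENNReal.ofReal_prod_of_nonneg fun _ _ => (Real.exp_pos _).le]
  simp_rw [hpath]
  have hanti : Antitone fun s : ℝ => ENNReal.ofReal (Real.exp (-l * s)) := fun s s' h =>
    ENNReal.ofReal_le_ofReal (Real.exp_le_exp.2 (by nlinarith))
  apply le_antisymm
  · rw [siteTime, Antitone.map_ciInf_of_continuousAt (f := fun s : ℝ =>
      ENNReal.ofReal (Real.exp (-l * s))) 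
      (ENNReal.continuous_ofReal.comp (by fun_prop)).continuousAt hanti (bddBelow_pathTime ht x y)]
    exact iSup_le fun γ => le_iSup_of_le ⟨γ.bypass, γ.bypass_isPath⟩
      (hanti (pathTime_bypass_le ht γ))
  · exact iSup_le fun γ => hanti (siteTime_le_pathTime ht γ.1)

end Paths

/-! ### Laplace transforms of passage times and their submultiplicativity -/

section Laplace

variable {d : ℕ} {Ω : Type*} [MeasurableSpace Ω]

lemma measurable_pathTime {x y : Fin d → ℤ} (γ : (lattice d).Walk x y) :
    Measurable fun t : Edge d → ℝ => pathTime t γ := by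
  induction γ with
  | nil => exact measurable_const
  | cons h γ ih => exact (measurable_pi_apply _).add ih

lemma measurable_siteTime (x y : Fin d → ℤ) :
    Measurable fun t : Edge d → ℝ => siteTime t x y :=
  Measurable.iInf fun γ => measurable_pathTime γ

/-- The Laplace transform of the passage time between two sites. -/
noncomputable def laplace (P : Measure Ω) (τ : Edge d → Ω → ℝ) (l : ℝ) (x y : Fin d → ℤ) :
    ℝ≥0∞ :=
  ∫⁻ ω, ENNReal.ofReal (Real.exp (-l * siteTime (fun e => τ e ω) x y)) ∂P

variable {P : Measure Ω} {τ : Edge d → Ω → ℝ}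

lemma measurable_siteTime_field (hm : ∀ e, Measurable (τ e)) (x y : Fin d → ℤ) :
    Measurable fun ω => siteTime (fun e => τ e ω) x y :=
  (measurable_siteTime x y).comp (by fun_prop : Measurable fun ω e => τ e ω)

/-- If every lattice path from `x` to `y` visits the set `Z`, the Laplace transform of the passage
time is bounded by the sum over `Z` of the products of the two partial Laplace transforms. -/
theorem laplace_le_tsum_mul [IsProbabilityMeasure P] (hm : ∀ e, Measurable (τ e)) (hi : iIndepFun τ P)
    (h0 : ∀ e ω, 0 ≤ τ e ω) {l : ℝ} (hl : 0 ≤ l) {x y : Fin d → ℤ} {Z : Set (Fin d → ℤ)}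
    (hZ : ∀ γ : (lattice d).Walk x y, ∃ z ∈ γ.support, z ∈ Z) :
    laplace P τ l x y ≤ ∑' z : Z, laplace P τ l x z * laplace P τ l z y := by
  classical
  set w : Edge d → Ω → ℝ≥0∞ := fun e ω => ENNReal.ofReal (Real.exp (-l * τ e ω)) with hw
  have hmw : ∀ e, Measurable (w e) := fun e => by
    have := hm e
    exact ENNReal.measurable_ofReal.comp (by fun_prop)
  have hiw : iIndepFun w P :=
    hi.comp (fun _ s => ENNReal.ofReal (Real.exp (-l * s)))
      fun _ => ENNReal.measurable_ofReal.comp (by fun_prop)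
  have hexp (ω) (a b : Fin d → ℤ) :
      ENNReal.ofReal (Real.exp (-l * siteTime (fun e => τ e ω) a b)) =
      ⨆ γ : {γ : (lattice d).Walk a b // γ.IsPath}, ∏ e ∈ edgeFinset γ.1, w e ω :=
    ofReal_exp_siteTime (fun e => h0 e ω) hl a b
  set Q := {γ : (lattice d).Walk x y // γ.IsPath}
  have : Countable Q := inferInstanceAs (Countable (Subtype _))
  have hdir : Directed (· ≤ ·) fun (s : Finset Q) ω => ⨆ γ ∈ s, ∏ e ∈ edgeFinset γ.1, w e ω := by
    refine Monotone.directed_le fun s s' hs ω => ?_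
    exact biSup_mono fun γ hγ => hs hγ
  calc laplace P τ l x y
      = ∫⁻ ω, (⨆ s : Finset Q, ⨆ γ ∈ s, ∏ e ∈ edgeFinset γ.1, w e ω) ∂P := by
        refine lintegral_congr fun ω => ?_
        rw [hexp, iSup_eq_iSup_finset]
    -- Decoupling is available for finite families only; monotone convergence reduces to finitely
    -- many paths.
    _ = ⨆ s : Finset Q, ∫⁻ ω, (⨆ γ ∈ s, ∏ e ∈ edgeFinset γ.1, w e ω) ∂P := by
        refine lintegral_iSup_directed_of_measurable (fun s => ?_) hdir
        exact measurable_finset_iSup fun γ => Finset.measurable_fun_prod _ fun e _ => hmw e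
    _ ≤ _ := iSup_le fun s => ?_
  -- Each path is cut at a visited site of `Z`; as its edges are distinct, the two pieces are
  -- edge-disjoint.
  choose z hz hzZ using fun γ : Q => hZ γ.1
  set A : Q → Finset (Edge d) := fun γ => edgeFinset (γ.1.takeUntil (z γ) (hz γ)) with hA
  set B : Q → Finset (Edge d) := fun γ => edgeFinset (γ.1.dropUntil (z γ) (hz γ)) with hB
  have hsplit (γ : Q) : edgeList γ.1 =
      edgeList (γ.1.takeUntil (z γ) (hz γ)) ++ edgeList (γ.1.dropUntil (z γ) (hz γ)) := by
    rw [← edgeList_append, SimpleGraph.Walk.take_spec]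
  have hdisj (γ : Q) : Disjoint (A γ) (B γ) := by
    have h := edgeList_nodup γ.2
    rw [hsplit, List.nodup_append'] at h
    simp only [hA, hB, edgeFinset]
    exact List.disjoint_toFinset_iff_disjoint.2 h.2.2
  have hprod (γ : Q) (ω) : ∏ e ∈ edgeFinset γ.1, w e ω =
      (∏ e ∈ A γ, w e ω) * ∏ e ∈ B γ, w e ω := by
    rw [← Finset.prod_union (hdisj γ), edgeFinset, hsplit, List.toFinset_append]
    rfl
  have key := lintegral_iSup_prod_mul_prod_le_of_iIndepFun P hmw hiw
    (s.image fun γ => (A γ, B γ)) (by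
      simp only [Finset.mem_image]
      rintro _ ⟨γ, -, rfl⟩
      exact hdisj γ)
  simp only [Finset.iSup_finset_image] at key
  have hmz (a b : Fin d → ℤ) : Measurable fun ω =>
      ENNReal.ofReal (Real.exp (-l * siteTime (fun e => τ e ω) a b)) := by
    have := measurable_siteTime_field hm a b
    exact ENNReal.measurable_ofReal.comp (by fun_prop)
  calc _ = ∫⁻ ω, (⨆ γ ∈ s, (∏ e ∈ A γ, w e ω) * ∏ e ∈ B γ, w e ω) ∂P := by
        simp_rw [hprod]
    _ ≤ _ := key
    _ ≤ ∫⁻ ω, ∑' z : Z,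
        ENNReal.ofReal (Real.exp (-l * siteTime (fun e => τ e ω.1) x z)) *
        ENNReal.ofReal (Real.exp (-l * siteTime (fun e => τ e ω.2) z y)) ∂(P.prod P) := by
        refine lintegral_mono fun ω => iSup₂_le fun γ _ => ?_
        refine le_trans ?_ (ENNReal.le_tsum (⟨z γ, hzZ γ⟩ : Z))
        rw [hexp, hexp]
        refine mul_le_mul' ?_ ?_
        · exact le_iSup_of_le ⟨_, γ.2.takeUntil (hz γ)⟩ le_rfl
        · exact le_iSup_of_le ⟨_, γ.2.dropUntil (hz γ)⟩ le_rfl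
    _ = ∑' z : Z, ∫⁻ ω,
        ENNReal.ofReal (Real.exp (-l * siteTime (fun e => τ e ω.1) x z)) *
        ENNReal.ofReal (Real.exp (-l * siteTime (fun e => τ e ω.2) z y)) ∂(P.prod P) :=
        lintegral_tsum fun z => (((hmz x z).comp measurable_fst).mul
          ((hmz z y).comp measurable_snd)).aemeasurable
    _ = _ := by
        refine tsum_congr fun z => ?_
        rw [lintegral_prod_mul (hmz x z).aemeasurable (hmz z y).aemeasurable]
        rfl

/-! ### Invariance under automorphisms of the lattice -/

lemma pathTime_map (t : Edge d → ℝ) (φ : lattice d ≃g lattice d) {x y : Fin d → ℤ}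
    (γ : (lattice d).Walk x y) :
    pathTime t (γ.map φ.toHom) = pathTime (fun e => t (φ.mapEdgeSet e)) γ := by
  induction γ with
  | nil => rfl
  | cons h γ ih => simp only [SimpleGraph.Walk.map_cons, pathTime, ih]; rfl

lemma siteTime_map_le {t : Edge d → ℝ} (ht : ∀ e, 0 ≤ t e) (φ : lattice d ≃g lattice d)
    (x y : Fin d → ℤ) : siteTime t (φ x) (φ y) ≤ siteTime (fun e => t (φ.mapEdgeSet e)) x y := by
  refine le_ciInf fun γ => ?_
  rw [← pathTime_map]
  exact siteTime_le_pathTime ht _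

lemma siteTime_map {t : Edge d → ℝ} (ht : ∀ e, 0 ≤ t e) (φ : lattice d ≃g lattice d)
    (x y : Fin d → ℤ) : siteTime t (φ x) (φ y) = siteTime (fun e => t (φ.mapEdgeSet e)) x y := by
  refine le_antisymm (siteTime_map_le ht φ x y) ?_
  have := siteTime_map_le (fun e => ht (φ.mapEdgeSet e)) φ.symm (φ x) (φ y)
  have h2 (e : Edge d) : φ.mapEdgeSet (φ.symm.mapEdgeSet e) = e :=
    φ.mapEdgeSet.apply_symm_apply e
  simp only [h2, RelIso.symm_apply_apply] at this
  exact this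

/-- An automorphism permutes the edges, and the law of an i.i.d. field, a product of equal
marginals, is unchanged by a permutation of indices. -/
theorem laplace_map (hm : ∀ e, Measurable (τ e)) (hi : iIndepFun τ P)
    (hid : ∀ e e', IdentDistrib (τ e) (τ e') P P)
    (h0 : ∀ e ω, 0 ≤ τ e ω) (l : ℝ) (φ : lattice d ≃g lattice d) (x y : Fin d → ℤ) :
    laplace P τ l (φ x) (φ y) = laplace P τ l x y := by
  have hG : Measurable fun t : Edge d → ℝ =>
      ENNReal.ofReal (Real.exp (-l * siteTime t x y)) := by
    have := measurable_siteTime x y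
    exact ENNReal.measurable_ofReal.comp (by fun_prop)
  have h1 : P.map (fun ω e => τ e ω) = P.map (fun ω e => τ (φ.mapEdgeSet e) ω) := by
    rw [hi.map_fun_eq_infinitePi_map hm, (hi.precomp φ.mapEdgeSet.injective).map_fun_eq_infinitePi_map
      fun e => hm _]
    congr 1
    funext e
    exact (hid _ _).map_eq
  have hm1 : Measurable fun ω e => τ e ω := by fun_prop
  have hm2 : Measurable fun ω e => τ (φ.mapEdgeSet e) ω := by fun_prop
  calc laplace P τ l (φ x) (φ y)
      = ∫⁻ ω, ENNReal.ofReal (Real.exp (-l * siteTime (fun e => τ (φ.mapEdgeSet e) ω) x y)) ∂P := by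
        refine lintegral_congr fun ω => ?_
        rw [siteTime_map fun e => h0 e ω]
    _ = ∫⁻ t, ENNReal.ofReal (Real.exp (-l * siteTime t x y))
          ∂(P.map (fun ω e => τ (φ.mapEdgeSet e) ω)) := (lintegral_map hG hm2).symm
    _ = _ := by rw [← h1, lintegral_map hG hm1]; rfl

/-- Translation by a site, as a lattice automorphism. -/
def translation (a : Fin d → ℤ) : lattice d ≃g lattice d where
  toEquiv := Equiv.addRight a
  map_rel_iff' := by intro x y; simp [lattice]

/-- A permutation of the coordinates followed by sign changes, as a lattice automorphism. -/
def signedPerm (s : Fin d → ℤˣ) (σ : Equiv.Perm (Fin d)) : lattice d ≃g lattice d where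
  toFun x i := s i * x (σ i)
  invFun x i := (s (σ.symm i) : ℤ) * x (σ.symm i)
  left_inv x := by
    funext i
    simp [← mul_assoc, ← Units.val_mul]
  right_inv x := by
    funext i
    simp [← mul_assoc, ← Units.val_mul]
  map_rel_iff' := by
    intro x y
    simp only [lattice, Equiv.coe_fn_mk, ← mul_sub, abs_mul, Int.isUnit_iff_abs_eq.1 (s _).isUnit,
      one_mul]
    rw [Equiv.sum_comp σ fun i => |x i - y i|]

lemma laplace_le_one [IsProbabilityMeasure P] (h0 : ∀ e ω, 0 ≤ τ e ω) {l : ℝ} (hl : 0 ≤ l) (x y : Fin d → ℤ) :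
    laplace P τ l x y ≤ 1 := by
  refine (lintegral_mono (g := fun _ => 1) fun ω => ?_).trans (by simp)
  rw [← ENNReal.ofReal_one]
  refine ENNReal.ofReal_le_ofReal (Real.exp_le_one_iff.2 ?_)
  have := mul_nonneg hl (siteTime_nonneg (fun e => h0 e ω) x y)
  linarith

lemma laplace_anti (h0 : ∀ e ω, 0 ≤ τ e ω) {l l' : ℝ} (hl : l ≤ l') (x y : Fin d → ℤ) :
    laplace P τ l' x y ≤ laplace P τ l x y := by
  refine lintegral_mono fun ω => ENNReal.ofReal_le_ofReal (Real.exp_le_exp.2 ?_)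
  have := mul_le_mul_of_nonneg_right hl (siteTime_nonneg (fun e => h0 e ω) x y)
  linarith

end Laplace

/-! ### Slabs, lattice symmetries and Chernoff bounds from the origin -/

section Model

variable {d : ℕ} {Ω : Type*} [MeasurableSpace Ω]

/-- I.i.d. edge weights with values in `[0, C]`, everywhere on the sample space. -/
structure IsClampedField (P : Measure Ω) (τ : Edge d → Ω → ℝ) (C : ℝ) : Prop where
  measurable : ∀ e, Measurable (τ e)
  indep : iIndepFun τ P
  identDistrib : ∀ e e', IdentDistrib (τ e) (τ e') P P
  nonneg : ∀ e ω, 0 ≤ τ e ω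
  le : ∀ e ω, τ e ω ≤ C

/-- The passage time from the origin to the site `z`. -/
noncomputable def hitTime (τ : Edge d → Ω → ℝ) (z : Fin d → ℤ) (ω : Ω) : ℝ :=
  siteTime (fun e => τ e ω) 0 z

/-- The Laplace transform at `l` of the passage time from the origin to `z`. -/
noncomputable def psi (P : Measure Ω) (τ : Edge d → Ω → ℝ) (l : ℝ) (z : Fin d → ℤ) : ℝ :=
  (laplace P τ l 0 z).toReal

/-- The linear functional with coefficients `m`, on sites. -/
def height (m : Fin d → ℝ) (z : Fin d → ℤ) : ℝ := ∑ i, m i * (z i : ℝ)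

lemma height_sub (m : Fin d → ℝ) (x z : Fin d → ℤ) :
    height m (x - z) = height m x - height m z := by
  simp [height, mul_sub, Finset.sum_sub_distrib]

lemma height_zero (m : Fin d → ℝ) : height m 0 = 0 := by simp [height]

/-- The lower tail of the passage time to `z`, relative to the level `M * height m z`. -/
noncomputable def lowerTail (P : Measure Ω) (τ : Edge d → Ω → ℝ) (m : Fin d → ℝ) (M : ℝ)
    (z : Fin d → ℤ) (s : ℝ) : ℝ :=
  P.real {ω | hitTime τ z ω < M * height m z - s}

variable {P : Measure Ω} {τ : Edge d → Ω → ℝ} {C : ℝ}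

lemma lowerTail_le_one [IsProbabilityMeasure P] (m : Fin d → ℝ) (M : ℝ) (z : Fin d → ℤ) (s : ℝ) :
    lowerTail P τ m M z s ≤ 1 := measureReal_le_one

lemma psi_nonneg (l : ℝ) (z : Fin d → ℤ) : 0 ≤ psi P τ l z := ENNReal.toReal_nonneg

namespace IsClampedField

variable (hτ : IsClampedField P τ C)
include hτ

lemma hitTime_nonneg (z : Fin d → ℤ) (ω : Ω) : 0 ≤ hitTime τ z ω :=
  siteTime_nonneg (fun e => hτ.nonneg e ω) _ _

lemma measurable_hitTime (z : Fin d → ℤ) : Measurable (hitTime τ z) :=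
  measurable_siteTime_field hτ.measurable 0 z

lemma ofReal_psi [IsProbabilityMeasure P] {l : ℝ} (hl : 0 ≤ l) (z : Fin d → ℤ) :
    ENNReal.ofReal (psi P τ l z) = laplace P τ l 0 z :=
  ENNReal.ofReal_toReal
    (ne_top_of_le_ne_top ENNReal.one_ne_top (laplace_le_one hτ.nonneg hl 0 z))

lemma psi_le_one [IsProbabilityMeasure P] {l : ℝ} (hl : 0 ≤ l) (z : Fin d → ℤ) : psi P τ l z ≤ 1 :=
  ENNReal.toReal_le_of_le_ofReal zero_le_one
    (by simpa using laplace_le_one hτ.nonneg hl 0 z)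

lemma psi_anti [IsProbabilityMeasure P] {l l' : ℝ} (hl : 0 ≤ l) (hll : l ≤ l') (z : Fin d → ℤ) :
    psi P τ l' z ≤ psi P τ l z :=
  ENNReal.toReal_mono
    (ne_top_of_le_ne_top ENNReal.one_ne_top (laplace_le_one hτ.nonneg hl 0 z))
    (laplace_anti hτ.nonneg hll 0 z)

lemma laplace_eq_sub (l : ℝ) (z x : Fin d → ℤ) :
    laplace P τ l z x = laplace P τ l 0 (x - z) := by
  have := laplace_map hτ.measurable hτ.indep hτ.identDistrib hτ.nonneg l (translation z) 0 (x - z)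
  have h1 : translation z 0 = z := zero_add z
  have h2 : translation z (x - z) = x := sub_add_cancel x z
  rwa [h1, h2] at this

lemma psi_signedPerm (l : ℝ) (s : Fin d → ℤˣ) (σ : Equiv.Perm (Fin d)) (z : Fin d → ℤ) :
    psi P τ l (signedPerm s σ z) = psi P τ l z := by
  have := laplace_map hτ.measurable hτ.indep hτ.identDistrib hτ.nonneg l (signedPerm s σ) 0 z
  have h0 : signedPerm s σ (0 : Fin d → ℤ) = 0 := by
    funext i
    change (s i : ℤ) * (0 : Fin d → ℤ) (σ i) = 0
    simp
  rw [h0] at this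
  rw [psi, this, psi]

/-- Submultiplicativity of the Laplace transforms across a slab. -/
lemma psi_le_tsum [IsProbabilityMeasure P] {l : ℝ} (hl : 0 ≤ l) (m : Fin d → ℝ) {b K : ℝ} (hb : ∀ i, |m i| < b) (hK : 0 < K)
    {x : Fin d → ℤ} (hx : K ≤ height m x) {g : (Fin d → ℤ) → ℝ} (hg0 : ∀ z, 0 ≤ g z)
    (hg : Summable g)
    (h : ∀ z, K ≤ height m z → height m z < K + b → psi P τ l z * psi P τ l (x - z) ≤ g z) :
    psi P τ l x ≤ ∑' z, g z := by
  set Z : Set (Fin d → ℤ) := {z | K ≤ height m z ∧ height m z < K + b}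
  -- One edge raises the height by less than b, so a path entering heights at least K from below
  -- lands in the slab.
  have hstep {y y' : Fin d → ℤ} (hyy : (lattice d).Adj y y') : height m y' < height m y + b := by
    have h1 : ∑ i, |y i - y' i| = 1 := hyy
    obtain ⟨i, hi⟩ : ∃ i, y i - y' i ≠ 0 := by
      by_contra! hc
      simp [hc] at h1
    have hb0 : 0 ≤ b := (abs_nonneg _).trans (hb i).le
    have h2 : height m y' - height m y ≤ ∑ j, |m j| * |((y j - y' j : ℤ) : ℝ)| := by
      rw [← height_sub]
      refine Finset.sum_le_sum fun j _ => ?_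
      rw [← abs_mul]
      refine (le_abs_self _).trans (le_of_eq ?_)
      rw [abs_mul, abs_mul, Pi.sub_apply, ← abs_neg ((y' j - y j : ℤ) : ℝ)]
      push_cast
      ring_nf
    have h3 : ∑ j, |m j| * |((y j - y' j : ℤ) : ℝ)| < ∑ j, b * |((y j - y' j : ℤ) : ℝ)| := by
      refine Finset.sum_lt_sum (fun j _ => ?_) ⟨i, Finset.mem_univ i, ?_⟩
      · exact mul_le_mul_of_nonneg_right (hb j).le (abs_nonneg _)
      · exact mul_lt_mul_of_pos_right (hb i) (abs_pos.2 (by exact_mod_cast hi))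
    have h4 : ∑ j, b * |((y j - y' j : ℤ) : ℝ)| = b := by
      rw [← Finset.mul_sum]
      have : ∑ j, |((y j - y' j : ℤ) : ℝ)| = 1 := by exact_mod_cast h1
      rw [this, mul_one]
    linarith
  have hZ' : ∀ {y y' : Fin d → ℤ} (γ : (lattice d).Walk y y'), height m y < K + b →
      K ≤ height m y' → ∃ z ∈ γ.support, z ∈ Z := by
    intro y y' γ
    induction γ with
    | nil => exact fun h1 h2 => ⟨_, by simp, h2, h1⟩
    | @cons u v w hadj γ ih =>
      intro h1 h2
      by_cases hu : K ≤ height m u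
      · exact ⟨u, by simp, hu, h1⟩
      · obtain ⟨z, hz, hzZ⟩ := ih (by have := hstep hadj; linarith) h2
        exact ⟨z, by simp [hz], hzZ⟩
  -- Positivity of b is needed for the origin to lie below the top of the slab; in dimension 0 all
  -- heights vanish, against `hx`.
  have hbpos : 0 < b ∨ d = 0 := by
    rcases Nat.eq_zero_or_pos d with h | h
    · exact Or.inr h
    · exact Or.inl ((abs_nonneg _).trans_lt (hb ⟨0, h⟩))
  rcases hbpos with hb0 | rfl
  swap
  · simp [height] at hx; linarith
  have key := laplace_le_tsum_mul hτ.measurable hτ.indep hτ.nonneg hl (x := 0) (y := x) (Z := Z)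
    fun γ => hZ' γ (by rw [height_zero]; positivity) hx
  refine ENNReal.toReal_le_of_le_ofReal (tsum_nonneg hg0) (key.trans ?_)
  rw [ENNReal.ofReal_tsum_of_nonneg hg0 hg]
  refine le_trans (ENNReal.tsum_le_tsum fun z => ?_)
    (ENNReal.tsum_comp_le_tsum_of_injective (Subtype.val_injective (p := (· ∈ Z)))
      fun z => ENNReal.ofReal (g z))
  rw [hτ.laplace_eq_sub l z.1 x, ← hτ.ofReal_psi hl, ← hτ.ofReal_psi hl,
    ← ENNReal.ofReal_mul (psi_nonneg _ _)]
  exact ENNReal.ofReal_le_ofReal (h z z.2.1 z.2.2)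

/-- Every site can be moved by a symmetry of the lattice to one of large height. -/
lemma exists_height_ge (m : Fin d → ℝ) (i : Fin d) (z : Fin d → ℤ) :
    ∃ z', (∀ l, psi P τ l z' = psi P τ l z) ∧ |m i| * ‖z‖ ≤ height m z' := by
  have : Nonempty (Fin d) := ⟨i⟩
  obtain ⟨j, hj⟩ : ∃ j, ‖z‖ = |(z j : ℝ)| := by
    obtain ⟨j, -, hj⟩ := Finset.exists_mem_eq_sup Finset.univ Finset.univ_nonempty
      fun j => ‖z j‖₊
    refine ⟨j, ?_⟩
    rw [Pi.norm_def, hj, coe_nnnorm, Int.norm_eq_abs]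
  -- The swap brings the largest coordinate to position i, and the signs make every term of the
  -- height nonnegative.
  set σ := Equiv.swap i j
  set s : Fin d → ℤˣ := fun k => if 0 ≤ m k * (z (σ k) : ℝ) then 1 else -1 with hs
  refine ⟨signedPerm s σ z, fun l => hτ.psi_signedPerm l s σ z, ?_⟩
  have hterm (k) : m k * ((signedPerm s σ z k : ℤ) : ℝ) = |m k * (z (σ k) : ℝ)| := by
    change m k * (((s k : ℤ) * z (σ k) : ℤ) : ℝ) = _
    simp only [hs]
    split_ifs with h
    · simp [abs_of_nonneg h]
    · simp [abs_of_neg (not_le.1 h)]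
  rw [height, Finset.sum_congr rfl fun k _ => hterm k]
  refine le_trans ?_ (Finset.single_le_sum (f := fun k => |m k * (z (σ k) : ℝ)|)
    (fun k _ => abs_nonneg _) (Finset.mem_univ i))
  simp [σ, abs_mul, hj]

/-- Chernoff's inequality for exp(-l T). -/
lemma lowerTail_le_exp_mul_psi [IsProbabilityMeasure P] (m : Fin d → ℝ) (M : ℝ) {l : ℝ} (hl : 0 ≤ l) (z : Fin d → ℤ)
    (s : ℝ) : lowerTail P τ m M z s ≤ Real.exp (l * (M * height m z - s)) * psi P τ l z := by
  set A := M * height m z - s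
  have hmeas : MeasurableSet {ω | hitTime τ z ω < A} :=
    measurableSet_lt (hτ.measurable_hitTime z) measurable_const
  rw [lowerTail, Measure.real]
  refine ENNReal.toReal_le_of_le_ofReal (mul_nonneg (Real.exp_pos _).le (psi_nonneg _ _)) ?_
  rw [ENNReal.ofReal_mul (Real.exp_pos _).le, hτ.ofReal_psi hl, laplace,
    ← lintegral_const_mul' _ _ ENNReal.ofReal_ne_top, ← lintegral_indicator_one hmeas]
  refine lintegral_mono fun ω => ?_
  by_cases hω : ω ∈ {ω | hitTime τ z ω < A}
  · rw [Set.indicator_of_mem hω, ← ENNReal.ofReal_mul (Real.exp_pos _).le, ← Real.exp_add,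
      Pi.one_apply, ← ENNReal.ofReal_one]
    refine ENNReal.ofReal_le_ofReal (Real.one_le_exp ?_)
    have : hitTime τ z ω < A := hω
    have := mul_le_mul_of_nonneg_left this.le hl
    unfold hitTime at this
    linarith
  · rw [Set.indicator_of_notMem hω]
    exact zero_le

/-- An exponential bound on the lower tail bounds the Laplace transform, up to a linear factor. -/
lemma psi_le_of_lowerTail [IsProbabilityMeasure P] {m : Fin d → ℝ} {M : ℝ} {l B : ℝ} (hl : 0 ≤ l)
    (hB : 0 ≤ B) {z : Fin d → ℤ} (hz : 0 ≤ M * height m z)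
    (h : ∀ s, 0 ≤ s → s ≤ M * height m z → Real.exp (l * s) * lowerTail P τ m M z s ≤ B) :
    psi P τ l z ≤
      Real.exp (-(l * (M * height m z))) * (1 + (M * height m z + 1) * Real.exp l * B) := by
  set A := M * height m z
  set n := ⌊A⌋₊
  have hn : (n : ℝ) ≤ A := Nat.floor_le hz
  have hmeas (j : ℕ) : MeasurableSet {ω | hitTime τ z ω < A - j} :=
    measurableSet_lt (hτ.measurable_hitTime z) measurable_const
  -- The deficit below A is cut into unit layers. Rounding it up costs the later factor exp(l), and
  -- nonnegativity of the passage time leaves at most A + 1 layers.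
  have hpt (ω) : Real.exp (-l * hitTime τ z ω) ≤ Real.exp (-(l * A)) * (1 +
      ∑ j ∈ Finset.range (n + 1), Real.exp (l * (j + 1)) *
        {ω | hitTime τ z ω < A - j}.indicator (fun _ => (1 : ℝ)) ω) := by
    have hnn (j : ℕ) : 0 ≤ Real.exp (l * (j + 1)) *
        {ω | hitTime τ z ω < A - j}.indicator (fun _ => (1 : ℝ)) ω :=
      mul_nonneg (Real.exp_pos _).le (Set.indicator_nonneg (fun _ _ => zero_le_one) _)
    have hsp : Real.exp (-l * hitTime τ z ω) =
        Real.exp (-(l * A)) * Real.exp (l * (A - hitTime τ z ω)) := by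
      rw [← Real.exp_add]; ring_nf
    rw [hsp]
    refine mul_le_mul_of_nonneg_left ?_ (Real.exp_pos _).le
    rcases le_or_gt (A - hitTime τ z ω) 0 with hY | hY
    · have h1 : Real.exp (l * (A - hitTime τ z ω)) ≤ 1 :=
        Real.exp_le_one_iff.2 (mul_nonpos_of_nonneg_of_nonpos hl hY)
      have h2 := Finset.sum_nonneg fun j (_ : j ∈ Finset.range (n + 1)) => hnn j
      linarith
    · set Y := A - hitTime τ z ω
      have hYA : Y ≤ A := by have := hτ.hitTime_nonneg z ω; simp only [Y]; linarith
      have hc : 0 < ⌈Y⌉₊ := Nat.ceil_pos.2 hY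
      obtain ⟨j, hj⟩ : ∃ j, ⌈Y⌉₊ = j + 1 := ⟨⌈Y⌉₊ - 1, by omega⟩
      have hj1 : (j : ℝ) < Y := Nat.lt_ceil.1 (by omega)
      have hj2 : Y ≤ j + 1 := by
        have := Nat.le_ceil Y; rw [hj] at this; exact_mod_cast this
      have hjn : j ≤ n := Nat.le_floor (by linarith)
      have hmem : ω ∈ {ω | hitTime τ z ω < A - j} := by
        simp only [Y] at hj1
        change hitTime τ z ω < A - j
        linarith
      have h1 := Finset.single_le_sum (fun j (_ : j ∈ Finset.range (n + 1)) => hnn j)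
        (Finset.mem_range.2 (by omega : j < n + 1))
      rw [Set.indicator_of_mem hmem, mul_one] at h1
      have h2 : Real.exp (l * Y) ≤ Real.exp (l * (j + 1)) :=
        Real.exp_le_exp.2 (mul_le_mul_of_nonneg_left hj2 hl)
      linarith
  have hpsi : psi P τ l z = ∫ ω, Real.exp (-l * hitTime τ z ω) ∂P := by
    rw [integral_eq_lintegral_of_nonneg_ae (ae_of_all _ fun _ => (Real.exp_pos _).le)]
    · rfl
    · have := hτ.measurable_hitTime z
      fun_prop
  have hint (j : ℕ) : Integrable (fun ω => Real.exp (l * (j + 1)) *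
        {ω | hitTime τ z ω < A - j}.indicator (fun _ => (1 : ℝ)) ω) P :=
    ((integrable_const (1 : ℝ)).indicator (hmeas j)).const_mul _
  have hint' : Integrable (fun ω => ∑ j ∈ Finset.range (n + 1), Real.exp (l * (j + 1)) *
        {ω | hitTime τ z ω < A - j}.indicator (fun _ => (1 : ℝ)) ω) P :=
    integrable_finsetSum _ fun j _ => hint j
  rw [hpsi]
  calc _ ≤ ∫ ω, Real.exp (-(l * A)) * (1 +
      ∑ j ∈ Finset.range (n + 1), Real.exp (l * (j + 1)) *
        {ω | hitTime τ z ω < A - j}.indicator (fun _ => (1 : ℝ)) ω) ∂P := by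
        refine integral_mono_of_nonneg (ae_of_all _ fun _ => (Real.exp_pos _).le) ?_
          (ae_of_all _ hpt)
        exact ((integrable_const 1).add hint').const_mul _
    _ = Real.exp (-(l * A)) * (1 + ∑ j ∈ Finset.range (n + 1), Real.exp (l * (j + 1)) *
        P.real {ω | hitTime τ z ω < A - j}) := by
        rw [integral_const_mul, integral_add (integrable_const 1) hint',
          integral_finsetSum _ fun j _ => hint j]
        simp only [integral_const_mul, integral_indicator_const _ (hmeas _)]
        simp
    _ ≤ _ := by
        refine mul_le_mul_of_nonneg_left ?_ (Real.exp_pos _).le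
        have : ∑ j ∈ Finset.range (n + 1), Real.exp (l * (j + 1)) *
            P.real {ω | hitTime τ z ω < A - j} ≤
            ∑ j ∈ Finset.range (n + 1), Real.exp l * B := by
          refine Finset.sum_le_sum fun j hj => ?_
          have hj' : j ≤ n := by have := Finset.mem_range.1 hj; omega
          have hjn : (j : ℝ) ≤ A := le_trans (by exact_mod_cast hj') hn
          have := h j (Nat.cast_nonneg j) hjn
          rw [lowerTail] at this
          calc _ = Real.exp l * (Real.exp (l * j) * P.real {ω | hitTime τ z ω < A - j}) := by
                rw [← mul_assoc, ← Real.exp_add]; ring_nf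
            _ ≤ _ := mul_le_mul_of_nonneg_left this (Real.exp_pos _).le
        rw [Finset.sum_const, Finset.card_range, nsmul_eq_mul] at this
        push_cast at this
        have h3 : ((n : ℝ) + 1) * (Real.exp l * B) ≤ (A + 1) * (Real.exp l * B) := by
          gcongr
        nlinarith

end IsClampedField

end Model

/-! ### Elementary estimates -/

section Estimates

/-- A smaller power is dominated by a larger one up to a constant. -/
lemma exists_mul_rpow_le {a b c B : ℝ} (hab : a < b) (ha : 0 ≤ a) (hc : 0 < c) (hB : 0 ≤ B) :
    ∃ A, 0 ≤ A ∧ ∀ r : ℝ, 0 ≤ r → B * r ^ a ≤ c * r ^ b + A := by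
  set r0 := (B / c) ^ (1 / (b - a))
  have hr0 : 0 ≤ r0 := by positivity
  refine ⟨B * r0 ^ a, by positivity, fun r hr => ?_⟩
  rcases le_or_gt r r0 with h | h
  · have : r ^ a ≤ r0 ^ a := Real.rpow_le_rpow hr h ha
    have h2 : 0 ≤ c * r ^ b := by positivity
    nlinarith [mul_le_mul_of_nonneg_left this hB]
  · have hrp : 0 < r := hr0.trans_lt h
    have h1 : B / c ≤ r ^ (b - a) := by
      have : r0 ^ (b - a) = B / c := by
        rw [← Real.rpow_mul (by positivity), one_div_mul_cancel (by linarith), Real.rpow_one]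
      rw [← this]
      exact Real.rpow_le_rpow hr0 h.le (by linarith)
    have h2 : r ^ b = r ^ (b - a) * r ^ a := by
      rw [← Real.rpow_add hrp]; ring_nf
    rw [div_le_iff₀ hc] at h1
    have h3 : 0 ≤ r ^ a := by positivity
    have h4 : 0 ≤ B * r0 ^ a := by positivity
    rw [h2]
    nlinarith [mul_le_mul_of_nonneg_right h1 h3]

/-- Powers are dominated by stretched exponentials. -/
lemma exists_pow_le_mul_exp {a s : ℝ} (ha : 0 < a) (hs : 0 < s) (p : ℕ) :
    ∃ A, 0 < A ∧ ∀ r : ℝ, 1 ≤ r → r ^ p ≤ A * Real.exp (a * r ^ s) := by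
  obtain ⟨n, hn⟩ := exists_nat_ge ((p : ℝ) / s)
  refine ⟨n.factorial / a ^ n, by positivity, fun r hr => ?_⟩
  have h1 := Real.pow_div_factorial_le_exp (a * r ^ s) (by positivity) n
  have h2 : r ^ p ≤ (r ^ s) ^ n := by
    rw [← Real.rpow_natCast, ← Real.rpow_natCast, ← Real.rpow_mul (by linarith)]
    refine Real.rpow_le_rpow_of_exponent_le hr ?_
    rw [div_le_iff₀ hs] at hn
    linarith
  rw [mul_pow, div_le_iff₀ (by positivity)] at h1
  rw [div_mul_eq_mul_div, le_div_iff₀ (by positivity)]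
  nlinarith [mul_le_mul_of_nonneg_left h2 (by positivity : 0 ≤ a ^ n)]

/-- Inverse powers of the norm of high order are summable over the lattice. -/
lemma summable_one_add_norm (d : ℕ) :
    Summable fun z : Fin d → ℤ => ((1 + ‖z‖) ^ (2 * d))⁻¹ := by
  classical
  -- The sup norm dominates each coordinate, so the summand is at most a product over coordinates of
  -- summable functions of one integer.
  set f : ℤ → ℝ := fun k => ((1 + |(k : ℝ)|) ^ 2)⁻¹ with hf
  have hf0 : ∀ k, 0 ≤ f k := fun k => by positivity
  have hfs : Summable f := by
    have h1 : Summable fun k : ℤ => 1 / (k : ℝ) ^ 2 :=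
      Real.summable_one_div_int_pow.2 (by norm_num)
    refine Summable.of_norm_bounded_eventually h1 ?_
    rw [Filter.eventually_cofinite]
    refine (Set.finite_singleton (0 : ℤ)).subset fun k hk => ?_
    by_contra hk0
    refine hk ?_
    have hk' : 0 < |(k : ℝ)| := abs_pos.2 (by exact_mod_cast hk0)
    rw [Real.norm_of_nonneg (hf0 k), one_div, ← sq_abs (k : ℝ)]
    exact inv_anti₀ (by positivity) (by gcongr; linarith)
  have hprod : Summable fun z : Fin d → ℤ => ∏ i, f (z i) := by
    refine summable_of_sum_le (c := ∏ _i : Fin d, ∑' k, f k)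
      (fun z => Finset.prod_nonneg fun i _ => hf0 _) fun s => ?_
    calc ∑ z ∈ s, ∏ i, f (z i) ≤
        ∑ z ∈ Fintype.piFinset fun i => s.image fun z => z i, ∏ i, f (z i) := by
          refine Finset.sum_le_sum_of_subset_of_nonneg (fun z hz => ?_)
            fun z _ _ => Finset.prod_nonneg fun i _ => hf0 _
          exact Fintype.mem_piFinset.2 fun i => Finset.mem_image_of_mem _ hz
      _ = ∏ i, ∑ k ∈ s.image fun z => z i, f k := (Finset.prod_univ_sum _ _).symm
      _ ≤ _ := Finset.prod_le_prod (fun i _ => Finset.sum_nonneg fun k _ => hf0 k)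
          fun i _ => hfs.sum_le_tsum _ fun k _ => hf0 k
  refine Summable.of_nonneg_of_le (fun z => by positivity) (fun z => ?_) hprod
  calc ((1 + ‖z‖) ^ (2 * d))⁻¹ = ∏ _i : Fin d, ((1 + ‖z‖) ^ 2)⁻¹ := by
        rw [Finset.prod_const, Finset.card_univ, Fintype.card_fin, inv_pow, pow_mul]
    _ ≤ _ := by
        refine Finset.prod_le_prod (fun i _ => by positivity) fun i _ => ?_
        have : |(z i : ℝ)| ≤ ‖z‖ := by rw [← Int.norm_eq_abs]; exact norm_le_pi_norm z i
        exact inv_anti₀ (by positivity) (by gcongr)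

end Estimates

/-! ### Bootstrapping the lower tail -/

section Bootstrap

variable {d : ℕ} {Ω : Type*} [MeasurableSpace Ω]

/-- Exponential decay of the lower tail beyond fluctuations of order `height ^ κ`. -/
def TailBound (P : Measure Ω) (τ : Edge d → Ω → ℝ) (m : Fin d → ℝ) (M κ : ℝ) : Prop :=
  ∃ c B : ℝ, 0 < c ∧ 0 < B ∧ ∀ z, 1 ≤ height m z → ∀ s, 0 ≤ s → s ≤ M * height m z →
    lowerTail P τ m M z s ≤ B * Real.exp (-(c * height m z ^ (-κ) * s))

/-- The Laplace transform version of `TailBound`. -/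
def LaplaceBound (P : Measure Ω) (τ : Edge d → Ω → ℝ) (m : Fin d → ℝ) (M κ : ℝ) : Prop :=
  ∃ c B : ℝ, 0 < c ∧ 0 < B ∧ ∀ z, 1 ≤ height m z → ∀ l, 0 ≤ l → l ≤ c * height m z ^ (-κ) →
    psi P τ l z ≤ B * height m z * Real.exp (-(l * (M * height m z)))

/-- Stretched exponential decay of the lower tail. -/
def StretchedTailBound (P : Measure Ω) (τ : Edge d → Ω → ℝ) (m : Fin d → ℝ) (M χ θ : ℝ) : Prop :=
  ∃ c B : ℝ, 0 < c ∧ 0 < B ∧ ∀ z, 1 ≤ height m z → ∀ s, 0 ≤ s → s ≤ M * height m z →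
    lowerTail P τ m M z s ≤ B * Real.exp (-(c * (s / height m z ^ χ) ^ θ))

variable {P : Measure Ω} {τ : Edge d → Ω → ℝ} {C : ℝ}
  {m : Fin d → ℝ} {M : ℝ}

/-- For l at most c times height^(-κ), the growth exp(l s) is cancelled by the decay of the tail;
summing the unit layers costs only a factor linear in the height. -/
lemma TailBound.laplaceBound [IsProbabilityMeasure P] (hτ : IsClampedField P τ C) (hM : 0 < M)
    {κ : ℝ} (hκ : 0 ≤ κ) (h : TailBound P τ m M κ) : LaplaceBound P τ m M κ := by
  obtain ⟨c, B, hc, hB, h⟩ := h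
  refine ⟨c, 1 + (M + 1) * Real.exp c * B, hc, by positivity, fun z hz l hl hlc => ?_⟩
  set r := height m z
  have hr0 : 0 < r := by linarith
  have hlc' : l ≤ c := by
    have : r ^ (-κ) ≤ 1 := Real.rpow_le_one_of_one_le_of_nonpos hz (by linarith)
    nlinarith
  have := hτ.psi_le_of_lowerTail (m := m) (M := M) hl hB.le (z := z) (by positivity)
    fun s hs hsr => by
      calc _ ≤ Real.exp (l * s) * (B * Real.exp (-(c * r ^ (-κ) * s))) :=
            mul_le_mul_of_nonneg_left (h z hz s hs hsr) (Real.exp_pos _).le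
        _ = B * Real.exp (l * s - c * r ^ (-κ) * s) := by
            rw [sub_eq_add_neg, Real.exp_add]; ring
        _ ≤ B * 1 := by
            gcongr
            rw [Real.exp_le_one_iff]
            nlinarith
        _ = B := mul_one B
  refine this.trans ?_
  rw [mul_comm]
  refine mul_le_mul_of_nonneg_right ?_ (Real.exp_pos _).le
  have h1 : Real.exp l ≤ Real.exp c := Real.exp_le_exp.2 hlc'
  have h2 : (M * r + 1) * Real.exp l * B ≤ ((M + 1) * r) * Real.exp c * B := by
    gcongr
    nlinarith
  nlinarith

lemma TailBound.mono {κ κ' : ℝ} (hκ : κ ≤ κ') (h : TailBound P τ m M κ) :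
    TailBound P τ m M κ' := by
  obtain ⟨c, B, hc, hB, h⟩ := h
  refine ⟨c, B, hc, hB, fun z hz s hs hsr => (h z hz s hs hsr).trans ?_⟩
  have := Real.rpow_le_rpow_of_exponent_le hz (neg_le_neg hκ)
  gcongr

/-- As s is at most M r, with r the height, s^θ is at least s (M r)^(-(1-θ)): a stretched
exponential is an exponential with the cruder exponent κ = 1 - θ + χθ, which is below 1 when χ is.
-/
lemma StretchedTailBound.tailBound (hM : 0 < M) {χ θ : ℝ} (hθ : 0 < θ) (hθ1 : θ < 1)
    (h : StretchedTailBound P τ m M χ θ) : TailBound P τ m M (1 - θ + χ * θ) := by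
  obtain ⟨c, B, hc, hB, h⟩ := h
  refine ⟨c * M ^ (-(1 - θ)), B, by positivity, hB, fun z hz s hs hsr =>
    (h z hz s hs hsr).trans ?_⟩
  set r := height m z
  have hr0 : 0 < r := by linarith
  gcongr B * Real.exp (-?_)
  rcases hs.eq_or_lt with rfl | hs0
  · simp [Real.zero_rpow hθ.ne']
  have h1 : s ^ (1 - θ) ≤ (M * r) ^ (1 - θ) := Real.rpow_le_rpow hs hsr (by linarith)
  have h2 : s = s ^ θ * s ^ (1 - θ) := by
    rw [← Real.rpow_add hs0]; simp
  rw [Real.div_rpow hs (by positivity), ← Real.rpow_mul hr0.le]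
  rw [Real.mul_rpow hM.le hr0.le] at h1
  calc c * M ^ (-(1 - θ)) * r ^ (-(1 - θ + χ * θ)) * s
      = c * M ^ (-(1 - θ)) * r ^ (-(1 - θ + χ * θ)) * s ^ θ * s ^ (1 - θ) := by
        conv_lhs => rw [h2]
        ring
    _ ≤ c * M ^ (-(1 - θ)) * r ^ (-(1 - θ + χ * θ)) * s ^ θ * (M ^ (1 - θ) * r ^ (1 - θ)) := by
        gcongr
    _ = c * (M ^ (-(1 - θ)) * M ^ (1 - θ)) * (r ^ (-(1 - θ + χ * θ)) * r ^ (1 - θ)) * s ^ θ := by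
        ring
    _ = c * (s ^ θ / r ^ (χ * θ)) := by
        rw [← Real.rpow_add hM, ← Real.rpow_add hr0]
        have e1 : -(1 - θ) + (1 - θ) = 0 := by ring
        have e2 : -(1 - θ + χ * θ) + (1 - θ) = -(χ * θ) := by ring
        rw [e1, e2, Real.rpow_zero, Real.rpow_neg hr0.le]
        field_simp

end Bootstrap

/-! ### Iteration over slabs of height K -/

section Slab

variable {d : ℕ} {Ω : Type*} [MeasurableSpace Ω]
  {P : Measure Ω} [IsProbabilityMeasure P] {τ : Edge d → Ω → ℝ} {C : ℝ}
  {m : Fin d → ℝ} {M : ℝ}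

/-- Bounds on the Laplace transform at scale `K`: summable decay in the slab at height `K`, and
the correct exponential rate up to height `2 * K`. -/
lemma LaplaceBound.exists_slab_bound (hτ : IsClampedField P τ C) (hM : 0 < M) {κ : ℝ} (hκ : 0 ≤ κ)
    (hκ1 : κ < 1) {i : Fin d} (hmi : m i ≠ 0) (b : ℝ) (h : LaplaceBound P τ m M κ) :
    ∃ c A : ℝ, 0 < c ∧ 1 ≤ A ∧ ∃ q : ℕ, ∃ K₁ : ℝ, 2 ≤ K₁ ∧ b ≤ K₁ ∧ ∀ K, K₁ ≤ K →
      (∀ z, K ≤ height m z → height m z < K + b →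
        psi P τ (c * K ^ (-κ)) z * Real.exp (c * K ^ (-κ) * (M * height m z)) ≤
          A * K ^ q * ((1 + ‖z‖) ^ (2 * d))⁻¹) ∧
      (∀ x, 0 ≤ height m x → height m x ≤ 2 * K →
        psi P τ (c * K ^ (-κ)) x ≤ A * K ^ q * Real.exp (-(c * K ^ (-κ) * (M * height m x)))) := by
  obtain ⟨c₀, B, hc₀, hB, h⟩ := h
  set a := |m i| with ha_def
  have ha : 0 < a := abs_pos.2 hmi
  have hκ1' : 0 < 1 - κ := by linarith
  -- Sites of norm beyond K^N count as remote. Since N (1 - κ) is at least 2, their symmetric images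
  -- of height r satisfy r^(1-κ) ≥ a^(1-κ) K^2, which beats the linear cost in K of the slab.
  obtain ⟨N, hN⟩ := exists_nat_ge (2 / (1 - κ))
  rw [div_le_iff₀ hκ1'] at hN
  have hN2 : 2 ≤ N := by
    have : (2 : ℝ) ≤ N := by nlinarith [mul_nonneg hκ (Nat.cast_nonneg (α := ℝ) N)]
    exact_mod_cast this
  obtain ⟨A₀, hA₀, hA₀'⟩ := exists_pow_le_mul_exp (a := c₀ * M / 2) (s := 1 - κ)
    (by positivity) hκ1' (2 * d + 1)
  set A' := B * (1 + 1 / a) ^ (2 * d) * A₀ with hA'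
  have hA'0 : 0 < A' := by positivity
  set A := B * 2 ^ (2 * d + 1) + A' + Real.exp (c₀ * M) with hA
  have hE1 : 1 ≤ Real.exp (c₀ * M) := Real.one_le_exp (by positivity)
  have hB2 : 0 < B * 2 ^ (2 * d + 1) := by positivity
  -- The factor 2^(-κ) makes the parameter equal to c₀ (2K)^(-κ), admissible in `LaplaceBound` at
  -- all heights from 1 to 2K.
  refine ⟨c₀ * 2 ^ (-κ), A, by positivity, by linarith, 2 * d * N + 1,
    2 + |b| + 2 / a + 4 / a ^ (1 - κ), ?_, ?_, ?_⟩
  · have : 0 ≤ |b| + 2 / a + 4 / a ^ (1 - κ) := by positivity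
    linarith
  · have : 0 ≤ 2 / a + 4 / a ^ (1 - κ) := by positivity
    linarith [le_abs_self b]
  intro K hK
  have hp1 : 0 ≤ |b| := abs_nonneg b
  have hp2 : 0 ≤ 2 / a := by positivity
  have hp3 : 0 ≤ 4 / a ^ (1 - κ) := by positivity
  have hK2 : 2 ≤ K := by linarith
  have hKb : b ≤ K := by linarith [le_abs_self b]
  have hKa : 2 ≤ K * a := by rw [← div_le_iff₀ ha]; linarith
  have hKa' : 4 ≤ K * a ^ (1 - κ) := by rw [← div_le_iff₀ (by positivity)]; linarith
  have hK0 : 0 < K := by linarith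
  have hlam : c₀ * 2 ^ (-κ) * K ^ (-κ) = c₀ * (2 * K) ^ (-κ) := by
    rw [Real.mul_rpow (by norm_num) hK0.le]; ring
  rw [hlam]
  set l := c₀ * (2 * K) ^ (-κ) with hl
  have hl0 : 0 ≤ l := by positivity
  have hlc : l ≤ c₀ := by
    exact mul_le_of_le_one_right hc₀.le
      (Real.rpow_le_one_of_one_le_of_nonpos (by linarith) (by linarith))
  have hmid (z : Fin d → ℤ) (h1 : 1 ≤ height m z) (h2 : height m z ≤ 2 * K) :
      psi P τ l z ≤ B * (2 * K) * Real.exp (-(l * (M * height m z))) := by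
    refine (h z h1 l hl0 ?_).trans ?_
    · rw [hl]
      have := Real.rpow_le_rpow_of_nonpos (by linarith) h2 (neg_nonpos.2 hκ)
      gcongr
    · gcongr
  have hKq : 1 ≤ K ^ (2 * d * N) := one_le_pow₀ (by linarith)
  have hKq' : 1 ≤ K ^ (2 * d * N + 1) := one_le_pow₀ (by linarith)
  constructor
  · intro z hz1 hz2
    rw [← div_eq_mul_inv, le_div_iff₀ (by positivity)]
    set t := ‖z‖
    have ht0 : 0 ≤ t := norm_nonneg z
    rcases le_or_gt t (K ^ N) with ht | ht
    · have h1 : psi P τ l z * Real.exp (l * (M * height m z)) ≤ B * (2 * K) := by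
        have := hmid z (by linarith) (by linarith)
        rwa [Real.exp_neg, ← div_eq_mul_inv, le_div_iff₀ (Real.exp_pos _)] at this
      have h2 : (1 + t) ^ (2 * d) ≤ 2 ^ (2 * d) * K ^ (2 * d * N) := by
        have h3 : 1 + t ≤ 2 * K ^ N := by
          have : 1 ≤ K ^ N := one_le_pow₀ (by linarith)
          linarith
        calc (1 + t) ^ (2 * d) ≤ (2 * K ^ N) ^ (2 * d) := by gcongr
          _ = _ := by rw [mul_pow, ← pow_mul]; ring_nf
      calc _ ≤ B * (2 * K) * (2 ^ (2 * d) * K ^ (2 * d * N)) := by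
            gcongr
        _ = B * 2 ^ (2 * d + 1) * K ^ (2 * d * N + 1) := by ring
        _ ≤ A * K ^ (2 * d * N + 1) := by gcongr; linarith
    -- At a remote site, use the image z' with its own smaller parameter c₀ r^(-κ). Half of the
    -- decay exp(-c₀ M r^(1-κ)) pays for the exponential tilt, half for the polynomial weight.
    · obtain ⟨z', hz', hz'h⟩ := hτ.exists_height_ge m i z
      set r := height m z'
      rw [← ha_def] at hz'h
      change a * t ≤ r at hz'h
      have hKN : K * K ≤ K ^ N := by
        rw [← pow_two]; exact pow_le_pow_right₀ (by linarith) hN2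
      have hr1 : a * K ^ N ≤ r := le_trans (by gcongr) hz'h
      have hr2 : 2 * K ≤ r := by
        calc 2 * K ≤ K * a * K := by gcongr
          _ = a * (K * K) := by ring
          _ ≤ a * K ^ N := by gcongr
          _ ≤ r := hr1
      have hr0 : 0 < r := by linarith
      have hr3 : 4 * K ≤ r ^ (1 - κ) := by
        have h1 : (a * K ^ N) ^ (1 - κ) ≤ r ^ (1 - κ) :=
          Real.rpow_le_rpow (by positivity) hr1 hκ1'.le
        have h2 : (2 : ℝ) ≤ N * (1 - κ) := hN
        have h3 : K ^ 2 ≤ (K ^ N) ^ (1 - κ) := by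
          rw [← Real.rpow_natCast, ← Real.rpow_natCast, ← Real.rpow_mul hK0.le]
          exact Real.rpow_le_rpow_of_exponent_le (by linarith) (by exact_mod_cast h2)
        rw [Real.mul_rpow ha.le (by positivity)] at h1
        have h4 : 0 < a ^ (1 - κ) := by positivity
        calc 4 * K ≤ K * a ^ (1 - κ) * K := by gcongr
          _ = a ^ (1 - κ) * K ^ 2 := by ring
          _ ≤ a ^ (1 - κ) * (K ^ N) ^ (1 - κ) := by gcongr
          _ ≤ _ := h1
      have h1 : psi P τ l z ≤ B * r * Real.exp (-(c₀ * M * r ^ (1 - κ))) := by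
        rw [← hz']
        have hle : c₀ * r ^ (-κ) ≤ l := by
          have := Real.rpow_le_rpow_of_nonpos (by linarith) hr2 (neg_nonpos.2 hκ)
          rw [hl]; gcongr
        refine (hτ.psi_anti (by positivity) hle z').trans ?_
        refine (h z' (by linarith) _ (by positivity) le_rfl).trans (le_of_eq ?_)
        have : r ^ (1 - κ) = r ^ (-κ) * r := by
          rw [← Real.rpow_add_one hr0.ne']; ring_nf
        rw [this]
        congr 2
        ring
      have h2 : Real.exp (l * (M * height m z)) ≤ Real.exp (c₀ * M / 2 * r ^ (1 - κ)) := by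
        rw [Real.exp_le_exp]
        have h3 : l * (M * height m z) ≤ c₀ * (M * (2 * K)) := by
          have : height m z ≤ 2 * K := by linarith
          have : 0 ≤ height m z := by linarith
          gcongr
        calc _ ≤ c₀ * (M * (2 * K)) := h3
          _ = c₀ * M / 2 * (4 * K) := by ring
          _ ≤ _ := by gcongr
      have h3 : (1 + t) ^ (2 * d) ≤ (1 + 1 / a) ^ (2 * d) * r ^ (2 * d) := by
        rw [← mul_pow]
        have : t ≤ 1 / a * r := by
          rw [one_div, inv_mul_eq_div, le_div_iff₀ ha]; linarith
        gcongr
        linarith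
      have h4 := hA₀' r (by linarith)
      calc _ ≤ B * r * Real.exp (-(c₀ * M * r ^ (1 - κ))) *
            Real.exp (c₀ * M / 2 * r ^ (1 - κ)) * ((1 + 1 / a) ^ (2 * d) * r ^ (2 * d)) := by
            gcongr
        _ = B * (1 + 1 / a) ^ (2 * d) * r ^ (2 * d + 1) *
            (Real.exp (-(c₀ * M * r ^ (1 - κ))) * Real.exp (c₀ * M / 2 * r ^ (1 - κ))) := by ring
        _ ≤ B * (1 + 1 / a) ^ (2 * d) * (A₀ * Real.exp (c₀ * M / 2 * r ^ (1 - κ))) *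
            (Real.exp (-(c₀ * M * r ^ (1 - κ))) * Real.exp (c₀ * M / 2 * r ^ (1 - κ))) := by
            gcongr
        _ = A' * (Real.exp (c₀ * M / 2 * r ^ (1 - κ)) *
            (Real.exp (-(c₀ * M * r ^ (1 - κ))) * Real.exp (c₀ * M / 2 * r ^ (1 - κ)))) := by
            rw [hA']; ring
        _ = A' := by
            rw [← Real.exp_add, ← Real.exp_add]
            ring_nf
            simp
        _ ≤ A := by linarith
        _ ≤ A * K ^ (2 * d * N + 1) := le_mul_of_one_le_right (by linarith) hKq'
  · intro x hx0 hx1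
    rcases le_or_gt 1 (height m x) with h1 | h1
    · refine (hmid x h1 hx1).trans ?_
      gcongr ?_ * _
      have : B * 2 ≤ A := by
        have : (1 : ℝ) ≤ 2 ^ (2 * d) := one_le_pow₀ (by norm_num)
        have := mul_le_mul_of_nonneg_left this (by positivity : 0 ≤ B * 2)
        rw [hA, pow_succ]
        linarith
      calc B * (2 * K) = (B * 2) * K := by ring
        _ ≤ A * K ^ (2 * d * N + 1) := by
          gcongr
          exact le_self_pow₀ (by linarith) (by omega)
    -- Below height 1 the trivial bound suffices, thanks to the summand exp(c₀ M) in `A`.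
    · refine (hτ.psi_le_one hl0 x).trans ?_
      have h2 : Real.exp (-(c₀ * M)) ≤ Real.exp (-(l * (M * height m x))) := by
        rw [Real.exp_le_exp]
        have : l * (M * height m x) ≤ c₀ * (M * 1) := by gcongr
        linarith
      calc (1 : ℝ) = Real.exp (c₀ * M) * Real.exp (-(c₀ * M)) := by rw [← Real.exp_add]; simp
        _ ≤ (A * K ^ (2 * d * N + 1)) * Real.exp (-(l * (M * height m x))) := by
          gcongr
          exact (by linarith : _ ≤ A).trans (le_mul_of_one_le_right (by linarith) hKq')

/-- Iterating submultiplicativity over slabs of height `K`. -/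
lemma LaplaceBound.exists_psi_le_rpow (hτ : IsClampedField P τ C) (hM : 0 < M) {κ : ℝ} (hκ : 0 ≤ κ)
    (hκ1 : κ < 1) {i : Fin d} (hmi : m i ≠ 0) (h : LaplaceBound P τ m M κ) :
    ∃ c A : ℝ, 0 < c ∧ 1 ≤ A ∧ ∃ q : ℕ, ∃ K₁ : ℝ, 2 ≤ K₁ ∧ ∀ K, K₁ ≤ K →
      ∀ x, 0 ≤ height m x → psi P τ (c * K ^ (-κ)) x ≤
        Real.exp (-(c * K ^ (-κ) * (M * height m x))) * (A * K ^ q) ^ (height m x / K + 2) := by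
  set b := 1 + ∑ i, |m i|
  have hb (i) : |m i| < b := by
    have := Finset.single_le_sum (f := fun i => |m i|) (fun i _ => abs_nonneg _)
      (Finset.mem_univ i)
    linarith
  obtain ⟨c, A, hc, hA, q, K₁, hK₁, hbK₁, hbound⟩ := h.exists_slab_bound hτ hM hκ hκ1 hmi b
  set W : (Fin d → ℤ) → ℝ := fun z => ((1 + ‖z‖) ^ (2 * d))⁻¹
  have hW0 : ∀ z, 0 ≤ W z := fun z => by positivity
  have hWs : Summable W := summable_one_add_norm d
  set S := ∑' z, W z
  have hS : 1 ≤ S := by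
    have := hWs.sum_le_tsum {0} fun z _ => hW0 z
    simpa [W] using this
  refine ⟨c, A * S, hc, by nlinarith, q, K₁, hK₁, fun K hK => ?_⟩
  obtain ⟨hslab, hbase⟩ := hbound K hK
  have hK0 : 0 < K := by linarith
  set l := c * K ^ (-κ)
  have hl0 : 0 ≤ l := by positivity
  set Q := A * S * K ^ q with hQ
  have hKq : 1 ≤ K ^ q := one_le_pow₀ (by linarith)
  have hAK : A * K ^ q ≤ Q := by
    rw [hQ]
    have : 0 < A * K ^ q := by positivity
    nlinarith
  have hQ1 : 1 ≤ Q := le_trans (by nlinarith) hAK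
  -- Each slab removes at least K from the height. For heights above 2K the remainder x - z has
  -- nonnegative height because b ≤ K; heights up to 2K are the base case.
  have claim (n : ℕ) : ∀ x, 0 ≤ height m x → height m x ≤ (n + 2) * K →
      psi P τ l x ≤ Real.exp (-(l * (M * height m x))) * Q ^ (n + 1) := by
    have hb' (n : ℕ) (x) (h0 : 0 ≤ height m x) (h2 : height m x ≤ 2 * K) :
        psi P τ l x ≤ Real.exp (-(l * (M * height m x))) * Q ^ (n + 1) := by
      refine (hbase x h0 h2).trans ?_
      rw [mul_comm]
      gcongr
      refine hAK.trans ?_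
      exact le_self_pow₀ hQ1 (by omega)
    induction n with
    | zero => exact fun x h0 h2 => hb' 0 x h0 (by simpa using h2)
    | succ n ih =>
      intro x h0 hx
      rcases le_or_gt (height m x) (2 * K) with h2 | h2
      · exact hb' _ x h0 h2
      have hE := Real.exp_pos (-(l * (M * height m x)))
      have hQn : 0 < Q ^ (n + 1) := by positivity
      have := hτ.psi_le_tsum hl0 m hb hK0 (x := x) (by linarith)
        (g := fun z => Real.exp (-(l * (M * height m x))) * Q ^ (n + 1) * (A * K ^ q) * W z)
        (fun z => mul_nonneg (by positivity) (hW0 z)) (hWs.mul_left _) fun z hz1 hz2 => by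
          have h3 := ih (x - z) (by rw [height_sub]; linarith)
            (by rw [height_sub]; push_cast at hx; linarith)
          calc psi P τ l z * psi P τ l (x - z)
              ≤ psi P τ l z * (Real.exp (-(l * (M * height m (x - z)))) * Q ^ (n + 1)) :=
                mul_le_mul_of_nonneg_left h3 (psi_nonneg _ _)
            _ = Real.exp (-(l * (M * height m x))) * Q ^ (n + 1) *
                (psi P τ l z * Real.exp (l * (M * height m z))) := by
                have : Real.exp (-(l * (M * height m (x - z)))) =
                    Real.exp (-(l * (M * height m x))) * Real.exp (l * (M * height m z)) := by
                  rw [← Real.exp_add, height_sub]; ring_nf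
                rw [this]; ring
            _ ≤ Real.exp (-(l * (M * height m x))) * Q ^ (n + 1) * (A * K ^ q * W z) :=
                mul_le_mul_of_nonneg_left (hslab z hz1 hz2) (by positivity)
            _ = _ := by ring
      refine this.trans (le_of_eq ?_)
      rw [tsum_mul_left, pow_succ Q (n + 1), hQ]
      ring
  intro x hx
  set n := ⌈height m x / K⌉₊
  have hn1 : height m x / K ≤ n := Nat.le_ceil _
  have hn2 : (n : ℝ) < height m x / K + 1 := Nat.ceil_lt_add_one (by positivity)
  refine (claim n x hx ?_).trans ?_
  · rw [div_le_iff₀ hK0] at hn1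
    linarith
  · rw [← Real.rpow_natCast]
    gcongr
    push_cast
    linarith

/-- The Chernoff bound obtained by cutting at scale `K`. -/
def ScaleBound (P : Measure Ω) (τ : Edge d → Ω → ℝ) (m : Fin d → ℝ) (M κ : ℝ) : Prop :=
  ∃ c q K₁ : ℝ, 0 < c ∧ 0 < q ∧ 2 ≤ K₁ ∧ ∀ K, K₁ ≤ K → ∀ x, 0 ≤ height m x → ∀ s,
    lowerTail P τ m M x s ≤
      Real.exp (-(c * K ^ (-κ) * s) + q * (height m x / K + 2) * Real.log K)

/-- Chernoff at parameter c K^(-κ). Since K ≥ 2, the constant A is at most a power of K and joins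
the term in log K. -/
lemma LaplaceBound.scaleBound (hτ : IsClampedField P τ C) (hM : 0 < M) {κ : ℝ} (hκ : 0 ≤ κ)
    (hκ1 : κ < 1) {i : Fin d} (hmi : m i ≠ 0) (h : LaplaceBound P τ m M κ) :
    ScaleBound P τ m M κ := by
  obtain ⟨c, A, hc, hA, q, K₁, hK₁, h⟩ := h.exists_psi_le_rpow hτ hM hκ hκ1 hmi
  have hlog2 : 0 < Real.log 2 := Real.log_pos (by norm_num)
  have hlogA : 0 ≤ Real.log A := Real.log_nonneg hA
  refine ⟨c, Real.log A / Real.log 2 + q + 1, K₁, hc, by positivity, hK₁, fun K hK x hx s => ?_⟩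
  have hK0 : 0 < K := by linarith
  have hl : 0 ≤ c * K ^ (-κ) := by positivity
  refine (hτ.lowerTail_le_exp_mul_psi m M hl x s).trans ?_
  refine (mul_le_mul_of_nonneg_left (h K hK x hx) (Real.exp_pos _).le).trans ?_
  have hAK : 0 < A * K ^ q := by positivity
  rw [Real.rpow_def_of_pos hAK, ← Real.exp_add, ← Real.exp_add, Real.exp_le_exp,
    Real.log_mul (by linarith) (by positivity), Real.log_pow]
  have hlogK : Real.log 2 ≤ Real.log K := Real.log_le_log (by norm_num) (by linarith)
  have h1 : Real.log A ≤ Real.log A / Real.log 2 * Real.log K := by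
    rw [div_mul_eq_mul_div, le_div_iff₀ hlog2]
    gcongr
  have h2 : 0 ≤ height m x / K + 2 := by positivity
  have h3 : Real.log A + q * Real.log K ≤
      (Real.log A / Real.log 2 + q + 1) * Real.log K := by nlinarith
  have h4 := mul_le_mul_of_nonneg_right h3 h2
  nlinarith

end Slab

/-! ### Lowering the exponent κ down to χ -/

section Improve

variable {d : ℕ} {Ω : Type*} [MeasurableSpace Ω]
  {P : Measure Ω} [IsProbabilityMeasure P] {τ : Edge d → Ω → ℝ} {C : ℝ}
  {m : Fin d → ℝ} {M : ℝ}

/-- The a priori stretched exponential bound controls small deviations and the bound by cutting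
at a smaller scale controls large deviations; together they improve the exponent. -/
lemma ScaleBound.tailBound (hM : 0 < M) {χ θ κ : ℝ} (hχ : 0 < χ) (hθ : 0 < θ) (hθ1 : θ < 1)
    (hκ : χ < κ) (hκ1 : κ < 1) (hS : StretchedTailBound P τ m M χ θ) (h : ScaleBound P τ m M κ) :
    TailBound P τ m M (κ * (1 - θ * (κ - χ) / 2)) := by
  obtain ⟨c₁, B₁, hc₁, hB₁, hS⟩ := hS
  obtain ⟨c, q, K₁, hc, hq, hK₁, h⟩ := h
  -- Deviations are split at r^(κ+δ). Below it, the a priori bound suffices if δ (1 - θ + κ) ≤ θ (κ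
  -- - χ) = 2δ, which holds since κ < 1 and θ > 0.
  set δ := θ * (κ - χ) / 2 with hδ
  have hκχ : 0 < κ - χ := by linarith
  have hκ0 : 0 < κ := by linarith
  have hδ0 : 0 < δ := by positivity
  have hδ1 : δ < 1 := by nlinarith
  have hδκ : 0 < δ * κ := by positivity
  -- The gain in the large regime is at least of order r^(δ+κδ), the cost of order r^δ log r; any η
  -- < κδ absorbs the logarithm.
  set η := κ * δ / 2 with hη
  have hη0 : 0 < η := by positivity
  obtain ⟨A, hA0, hA⟩ := exists_mul_rpow_le (a := δ + η) (b := δ + κ * δ) (c := c / 2)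
    (B := 3 * q / η) (by rw [hη]; nlinarith) (by positivity) (by positivity) (by positivity)
  set r₁ := K₁ ^ (1 / (1 - δ)) with hr₁
  have hr₁0 : 0 ≤ r₁ := by positivity
  set c' := min c₁ (c / 2) with hc'
  have hc'0 : 0 < c' := lt_min hc₁ (by positivity)
  refine ⟨c', B₁ + Real.exp A + Real.exp (c' * (M * r₁)), hc'0, by positivity,
    fun z hz s hs hsr => ?_⟩
  set r := height m z
  have hr0 : 0 < r := by linarith
  set E := Real.exp (-(c' * r ^ (-(κ * (1 - δ))) * s))
  have hE : 0 < E := Real.exp_pos _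
  have e1 := Real.exp_pos A
  have e2 := Real.exp_pos (c' * (M * r₁))
  rcases le_or_gt s (r ^ (κ + δ)) with hsmall | hlarge
  · have : lowerTail P τ m M z s ≤ B₁ * E := by
      refine (hS z hz s hs hsr).trans ?_
      refine mul_le_mul_of_nonneg_left (Real.exp_le_exp.2 (neg_le_neg ?_)) hB₁.le
      rcases hs.eq_or_lt with rfl | hs0
      · simp [Real.zero_rpow hθ.ne']
      have h2 : s = s ^ θ * s ^ (1 - θ) := by
        rw [← Real.rpow_add hs0]; simp
      have h1 : s ^ (1 - θ) ≤ r ^ ((κ + δ) * (1 - θ)) := by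
        rw [Real.rpow_mul hr0.le]
        exact Real.rpow_le_rpow hs hsmall (by linarith)
      have h3 : r ^ (-(κ * (1 - δ))) * r ^ ((κ + δ) * (1 - θ)) ≤ r ^ (-(χ * θ)) := by
        rw [← Real.rpow_add hr0]
        refine Real.rpow_le_rpow_of_exponent_le hz ?_
        have : 2 * δ = θ * (κ - χ) := by rw [hδ]; ring
        nlinarith
      have h4 : 0 < s ^ θ := by positivity
      rw [Real.div_rpow hs (by positivity), ← Real.rpow_mul hr0.le]
      calc c' * r ^ (-(κ * (1 - δ))) * s
          = c' * (r ^ (-(κ * (1 - δ))) * s ^ (1 - θ)) * s ^ θ := by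
            conv_lhs => rw [h2]
            ring
        _ ≤ c₁ * (r ^ (-(κ * (1 - δ))) * r ^ ((κ + δ) * (1 - θ))) * s ^ θ := by
            gcongr
            exact min_le_left _ _
        _ ≤ c₁ * r ^ (-(χ * θ)) * s ^ θ := by gcongr
        _ = c₁ * (s ^ θ / r ^ (χ * θ)) := by rw [Real.rpow_neg hr0.le]; field_simp
    nlinarith
  rcases le_or_gt K₁ (r ^ (1 - δ)) with hK | hK
  -- Large deviations: cut at scale r^(1-δ), so the exponential rate is r^(-κ(1-δ)) and there are
  -- about r^δ slabs.
  · have h1 := h (r ^ (1 - δ)) hK z hr0.le s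
    have : lowerTail P τ m M z s ≤ Real.exp A * E := by
      refine h1.trans ?_
      rw [← Real.exp_add, Real.exp_le_exp]
      have hrk : (r ^ (1 - δ)) ^ (-κ) = r ^ (-(κ * (1 - δ))) := by
        rw [← Real.rpow_mul hr0.le]; ring_nf
      have hrd : r / r ^ (1 - δ) = r ^ δ := by
        rw [div_eq_iff (by positivity), ← Real.rpow_add hr0]; simp
      rw [hrk, Real.log_rpow hr0]
      change -(c * r ^ (-(κ * (1 - δ))) * s) + q * (r / r ^ (1 - δ) + 2) * _ ≤ _
      rw [hrd]
      have hlog0 : 0 ≤ Real.log r := Real.log_nonneg hz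
      have hlog : Real.log r ≤ r ^ η / η := Real.log_le_rpow_div hr0.le hη0
      have hrδ : 1 ≤ r ^ δ := Real.one_le_rpow hz hδ0.le
      have k1 : q * (r ^ δ + 2) * ((1 - δ) * Real.log r) ≤ 3 * q / η * r ^ (δ + η) := by
        calc q * (r ^ δ + 2) * ((1 - δ) * Real.log r) ≤
            q * (3 * r ^ δ) * (1 * (r ^ η / η)) := by
              gcongr <;> linarith
          _ = _ := by rw [Real.rpow_add hr0]; ring
      have k2 := hA r hr0.le
      have k3 : r ^ (δ + κ * δ) ≤ r ^ (-(κ * (1 - δ))) * s := by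
        calc r ^ (δ + κ * δ) = r ^ (-(κ * (1 - δ))) * r ^ (κ + δ) := by
              rw [← Real.rpow_add hr0]; ring_nf
          _ ≤ _ := by gcongr
      have k4 : c' * (r ^ (-(κ * (1 - δ))) * s) ≤ c / 2 * (r ^ (-(κ * (1 - δ))) * s) := by
        gcongr
        exact min_le_right _ _
      have k5 : c / 2 * r ^ (δ + κ * δ) ≤ c / 2 * (r ^ (-(κ * (1 - δ))) * s) := by gcongr
      linarith
    nlinarith
  · have hrr : r ≤ r₁ := by
      have h1 : (r ^ (1 - δ)) ^ (1 / (1 - δ)) ≤ r₁ :=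
        Real.rpow_le_rpow (by positivity) hK.le (by
          have : 0 < 1 - δ := by linarith
          positivity)
      rwa [← Real.rpow_mul hr0.le, mul_one_div_cancel (by linarith), Real.rpow_one] at h1
    have : lowerTail P τ m M z s ≤ Real.exp (c' * (M * r₁)) * E := by
      refine (lowerTail_le_one _ _ _ _).trans ?_
      rw [← Real.exp_add]
      refine Real.one_le_exp ?_
      have h1 : r ^ (-(κ * (1 - δ))) ≤ 1 :=
        Real.rpow_le_one_of_one_le_of_nonpos hz (by nlinarith)
      have h2 : c' * (r ^ (-(κ * (1 - δ))) * s) ≤ c' * (1 * (M * r₁)) := by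
        have : s ≤ M * r₁ := hsr.trans (by gcongr)
        gcongr
      linarith
    nlinarith

/-- One improvement multiplies the gap κ - χ by 1 - κθ/2, which is less than the fixed ratio 1 -
χθ/2; finitely many rounds thus reach any κ > χ. -/
lemma StretchedTailBound.scaleBound (hτ : IsClampedField P τ C) (hM : 0 < M) {i : Fin d}
    (hmi : m i ≠ 0) {χ θ : ℝ} (hχ : 0 < χ) (hχ1 : χ < 1) (hθ : 0 < θ) (hθ1 : θ < 1)
    (hS : StretchedTailBound P τ m M χ θ) {κ : ℝ} (hκ : χ < κ) (hκ1 : κ < 1) :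
    ScaleBound P τ m M κ := by
  have hscale {κ : ℝ} (hκ : χ < κ) (hκ1 : κ < 1) (h : TailBound P τ m M κ) :
      ScaleBound P τ m M κ :=
    (h.laplaceBound hτ hM (by linarith)).scaleBound hτ hM (by linarith) hκ1 hmi
  have hχθ : χ * θ < 1 := by nlinarith
  have hχθ0 : 0 < χ * θ := by positivity
  have claim (n : ℕ) : ∃ κ, χ < κ ∧ κ < 1 ∧ κ - χ ≤ (1 - χ * θ / 2) ^ n ∧ TailBound P τ m M κ := by
    induction n with
    | zero => exact ⟨1 - θ + χ * θ, by nlinarith, by nlinarith, by nlinarith, hS.tailBound hM hθ hθ1⟩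
    | succ n ih =>
      obtain ⟨κ, h1, h2, h3, h4⟩ := ih
      refine ⟨κ * (1 - θ * (κ - χ) / 2), ?_, ?_, ?_,
        (hscale h1 h2 h4).tailBound hM hχ hθ hθ1 h1 h2 hS⟩
      · have hκθ : κ * θ < 1 := by nlinarith
        have : 0 < κ - χ := by linarith
        nlinarith
      · have : 0 < κ * (θ * (κ - χ)) := by
          have : 0 < κ - χ := by linarith
          have : 0 < κ := by linarith
          positivity
        nlinarith
      · have h5 : κ * (1 - θ * (κ - χ) / 2) - χ ≤ (κ - χ) * (1 - χ * θ / 2) := by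
          have : 0 ≤ (κ - χ) * (κ - χ) * θ := by
            have : 0 < κ - χ := by linarith
            positivity
          nlinarith
        rw [pow_succ]
        exact h5.trans (mul_le_mul_of_nonneg_right h3 (by linarith))
  obtain ⟨n, hn⟩ := exists_pow_lt_of_lt_one (x := κ - χ) (y := 1 - χ * θ / 2) (by linarith)
    (by linarith)
  obtain ⟨κ', -, -, h3, h4⟩ := claim n
  exact hscale hκ hκ1 (h4.mono (by linarith))

end Improve

/-! ### From concentration on the hyperplane to all lattice sites -/

section Concentration

variable {d : ℕ} {Ω : Type*} [MeasurableSpace Ω]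
  {P : Measure Ω} {τ : Edge d → Ω → ℝ} {C : ℝ}
  {m : Fin d → ℝ} {M : ℝ}

/-- Lower tail concentration with exponents `χ`, `θ`, at the endpoints on the hyperplane
`∑ i, m i * v i = 1`. -/
def HyperplaneConcentration (P : Measure Ω) (τ : Edge d → Ω → ℝ) (m : Fin d → ℝ) (M χ θ : ℝ) :
    Prop :=
  ∃ K₀ : ℕ, ∀ K : ℕ, K₀ ≤ K → ∀ a ∈ Set.Icc χ 1, ∀ v : EuclideanSpace ℝ (Fin d),
    ∑ i, m i * v i = 1 →
    P.real {ω | T (fun e => τ e ω) 0 ((K : ℝ) • v) < (K : ℝ) * M - (K : ℝ) ^ a}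
      ≤ Real.exp (-((K : ℝ) ^ (θ * (a - χ))))

lemma floorSite_zero : floorSite (0 : EuclideanSpace ℝ (Fin d)) = 0 := by
  funext i; simp [floorSite]

lemma T_zero_eq_hitTime {Ω : Type*} {τ : Edge d → Ω → ℝ} (x : EuclideanSpace ℝ (Fin d)) (ω : Ω) :
    T (fun e => τ e ω) 0 x = hitTime τ (floorSite x) ω := by
  rw [T, hitTime, floorSite_zero]

lemma HyperplaneConcentration.mono {χ θ θ' : ℝ} (hθ : θ' ≤ θ)
    (h : HyperplaneConcentration P τ m M χ θ) : HyperplaneConcentration P τ m M χ θ' := by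
  obtain ⟨K₀, h⟩ := h
  refine ⟨max K₀ 1, fun K hK a ha v hv => (h K (le_trans (le_max_left _ _) hK) a ha v hv).trans ?_⟩
  have hK1 : (1 : ℝ) ≤ K := by exact_mod_cast le_trans (le_max_right _ _) hK
  have : θ' * (a - χ) ≤ θ * (a - χ) := mul_le_mul_of_nonneg_right hθ (by linarith [ha.1])
  exact Real.exp_le_exp.2 (neg_le_neg (Real.rpow_le_rpow_of_exponent_le hK1 this))

/-- Replacing K by r/2 loses a factor at most 2, as the exponent θ (a - χ) is at most 1. -/
lemma half_mul_div_rpow_le {r K a χ θ ρ s : ℝ} (hr0 : 0 < r) (hK : r / 2 ≤ K) (ha : χ ≤ a)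
    (ha1 : a - χ ≤ 1) (hθ : 0 < θ) (hθ1 : θ ≤ 1) (hρ : 0 ≤ ρ) (hs : 0 ≤ s) (h : ρ * s ≤ r ^ a) :
    ρ ^ θ / 2 * (s / r ^ χ) ^ θ ≤ K ^ (θ * (a - χ)) := by
  have haχ : 0 ≤ a - χ := by linarith
  have hexp0 : 0 ≤ θ * (a - χ) := by positivity
  have hexp1 : θ * (a - χ) ≤ 1 := mul_le_one₀ hθ1 haχ ha1
  have h5 : (r / 2) ^ (θ * (a - χ)) ≤ K ^ (θ * (a - χ)) :=
    Real.rpow_le_rpow (by positivity) hK hexp0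
  have h6 : (2 : ℝ) ^ (θ * (a - χ)) ≤ 2 := by
    have := Real.rpow_le_rpow_of_exponent_le (by norm_num : (1 : ℝ) ≤ 2) hexp1
    rwa [Real.rpow_one] at this
  have h7 : r ^ (θ * (a - χ)) = (r ^ a / r ^ χ) ^ θ := by
    rw [mul_comm, Real.rpow_mul hr0.le, Real.rpow_sub hr0]
  have h8 : (ρ * (s / r ^ χ)) ^ θ ≤ (r ^ a / r ^ χ) ^ θ := by
    refine Real.rpow_le_rpow (by positivity) ?_ hθ.le
    rw [← mul_div_assoc]
    gcongr
  rw [Real.mul_rpow hρ (by positivity)] at h8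
  rw [Real.div_rpow hr0.le (by norm_num), h7] at h5
  have h9 : (r ^ a / r ^ χ) ^ θ / 2 ≤ (r ^ a / r ^ χ) ^ θ / (2 : ℝ) ^ (θ * (a - χ)) := by
    gcongr
  calc ρ ^ θ / 2 * (s / r ^ χ) ^ θ = (ρ ^ θ * (s / r ^ χ) ^ θ) / 2 := by ring
    _ ≤ (r ^ a / r ^ χ) ^ θ / 2 := by gcongr
    _ ≤ _ := h9.trans h5

/-- Concentration on the hyperplane, transferred to lattice sites. -/
lemma HyperplaneConcentration.lowerTail_le [IsProbabilityMeasure P] (hτ : IsClampedField P τ C) (hC : 0 ≤ C)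
    {u : EuclideanSpace ℝ (Fin d)} (hu : ‖u‖ = 1) (hmu : ∑ i, m i * u i = 1) {χ θ : ℝ}
    (h : HyperplaneConcentration P τ m M χ θ) :
    ∃ K₀ : ℕ, ∀ K : ℕ, K₀ ≤ K → ∀ a ∈ Set.Icc χ 1, ∀ z, (K : ℝ) ≤ height m z →
      height m z < K + 1 →
      P.real {ω | hitTime τ z ω < (K : ℝ) * M - (K : ℝ) ^ a - d * C}
        ≤ Real.exp (-((K : ℝ) ^ (θ * (a - χ)))) := by
  obtain ⟨K₀, h⟩ := h
  refine ⟨max K₀ 1, fun K hK a ha z hz1 hz2 => ?_⟩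
  have hK1 : (1 : ℝ) ≤ K := by exact_mod_cast le_trans (le_max_right _ _) hK
  have hK0 : (K : ℝ) ≠ 0 := by linarith
  set δ := height m z - K with hδ
  -- Sliding z by -δu, with 0 ≤ δ < 1, lands on K times the hyperplane. Each coordinate moves by
  -- less than 1, so after rounding the sites are within ℓ¹-distance d, at a cost d C.
  set y : EuclideanSpace ℝ (Fin d) := WithLp.toLp 2 (fun i => (z i : ℝ) - δ * u i) with hy
  have hyi (i) : y i = (z i : ℝ) - δ * u i := rfl
  have hKv : (K : ℝ) • ((K : ℝ)⁻¹ • y) = y := smul_inv_smul₀ hK0 y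
  have hv : ∑ i, m i * ((K : ℝ)⁻¹ • y) i = 1 := by
    have h1 : ∑ i, m i * ((K : ℝ)⁻¹ • y) i =
        (K : ℝ)⁻¹ * (height m z - δ * ∑ i, m i * u i) := by
      rw [height, Finset.mul_sum, ← Finset.sum_sub_distrib, Finset.mul_sum]
      refine Finset.sum_congr rfl fun i _ => ?_
      rw [PiLp.smul_apply, hyi, smul_eq_mul]
      ring
    rw [h1, hmu, hδ]
    field_simp
    ring
  refine le_trans ?_ (h K (le_trans (le_max_left _ _) hK) a ha _ hv)
  refine measureReal_mono fun ω hω => ?_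
  have hω' : hitTime τ z ω < (K : ℝ) * M - (K : ℝ) ^ a - d * C := hω
  change T (fun e => τ e ω) 0 _ < _
  rw [hKv, T_zero_eq_hitTime]
  have ht := siteTime_triangle (fun e => hτ.nonneg e ω) 0 z (floorSite y)
  have ht2 := siteTime_le (fun e => hτ.nonneg e ω) hC (fun e => hτ.le e ω) z (floorSite y)
  have hdist : ∑ i, |z i - floorSite y i| ≤ ∑ _i : Fin d, (1 : ℤ) := by
    refine Finset.sum_le_sum fun i _ => ?_
    have hui : |u i| ≤ 1 := by
      have := PiLp.norm_apply_le u i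
      rwa [hu, Real.norm_eq_abs] at this
    have h1 : |δ * u i| < 1 := by
      rw [abs_mul, abs_of_nonneg (by linarith : 0 ≤ δ)]
      have : 0 ≤ δ := by linarith
      nlinarith [abs_nonneg (u i)]
    rw [abs_lt] at h1
    have h2 : floorSite y i = ⌊(z i : ℝ) - δ * u i⌋ := rfl
    have h3 : z i - 1 ≤ floorSite y i := by
      rw [h2, Int.le_floor]; push_cast; linarith
    have h4 : floorSite y i < z i + 1 := by
      rw [h2, Int.floor_lt]; push_cast; linarith
    rw [abs_le]
    constructor <;> omega
  have h5 : ((∑ i, |z i - floorSite y i| : ℤ) : ℝ) * C ≤ d * C := by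
    refine mul_le_mul_of_nonneg_right ?_ hC
    have : ∑ i, |z i - floorSite y i| ≤ (d : ℤ) := by simpa using hdist
    exact_mod_cast this
  rw [hitTime] at hω' ⊢
  linarith

/-- A deviation s is encoded by an exponent a with r^a comparable to s, where r is the height;
freedom in a is what yields a bound for every s. Bounded r or bounded s / r^χ is absorbed into B. -/
lemma HyperplaneConcentration.stretchedTailBound [IsProbabilityMeasure P]
    (hτ : IsClampedField P τ C) (hC : 0 ≤ C)
    (hM : 0 < M) {u : EuclideanSpace ℝ (Fin d)} (hu : ‖u‖ = 1) (hmu : ∑ i, m i * u i = 1)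
    {χ θ : ℝ} (hχ : 0 < χ) (hχ1 : χ < 1) (hθ : 0 < θ) (hθ1 : θ < 1)
    (h : HyperplaneConcentration P τ m M χ θ) : StretchedTailBound P τ m M χ θ := by
  obtain ⟨K₀, h⟩ := h.lowerTail_le hτ hC hu hmu
  -- Total loss: d C from moving to the hyperplane, M from replacing r by its integer part. Beyond
  -- r₀ it is at most r^χ.
  set D := d * C + M with hD
  have hD0 : 0 < D := by positivity
  set r₀ := (K₀ : ℝ) + 2 + D ^ (1 / χ) with hr₀
  have hDχ : 0 ≤ D ^ (1 / χ) := by positivity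
  set ρ := min 1 (2 / M) / 2 with hρ
  have hρ0 : 0 < ρ := by positivity
  have hρ1 : ρ ≤ 1 / 2 := by
    have : min 1 (2 / M) ≤ 1 := min_le_left _ _
    linarith
  set c := ρ ^ θ / 2 with hc
  have hc0 : 0 < c := by positivity
  set B := 1 + Real.exp (c * (2 : ℝ) ^ θ) + Real.exp (c * (M * r₀) ^ θ) with hB
  have e1 := Real.exp_pos (c * (2 : ℝ) ^ θ)
  have e2 := Real.exp_pos (c * (M * r₀) ^ θ)
  refine ⟨c, B, hc0, by positivity, fun z hz s hs hsr => ?_⟩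
  set r := height m z with hr
  have hr0 : 0 < r := by linarith
  have hrχ : 0 < r ^ χ := by positivity
  set E := Real.exp (-(c * (s / r ^ χ) ^ θ)) with hE
  have hE0 : 0 < E := Real.exp_pos _
  have trivial_case {t : ℝ} (ht : s / r ^ χ ≤ t) :
      lowerTail P τ m M z s ≤ Real.exp (c * t ^ θ) * E := by
    refine (lowerTail_le_one _ _ _ _).trans ?_
    rw [hE, ← Real.exp_add]
    refine Real.one_le_exp ?_
    have : (s / r ^ χ) ^ θ ≤ t ^ θ := Real.rpow_le_rpow (by positivity) ht hθ.le
    linarith [mul_le_mul_of_nonneg_left this hc0.le]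
  rcases le_or_gt (s / r ^ χ) 2 with h2 | h2
  · exact (trivial_case h2).trans (mul_le_mul_of_nonneg_right (by linarith) hE0.le)
  rcases le_or_gt r r₀ with h3 | h3
  · have : s / r ^ χ ≤ M * r₀ := by
      rw [div_le_iff₀ hrχ]
      have h4 : 1 ≤ r ^ χ := Real.one_le_rpow hz hχ.le
      have h5 : M * r ≤ M * r₀ := by gcongr
      exact hsr.trans (h5.trans (le_mul_of_one_le_right (by positivity) h4))
    exact (trivial_case this).trans (mul_le_mul_of_nonneg_right (by linarith) hE0.le)
  have hr1 : 1 < r := by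
    have : (0 : ℝ) ≤ K₀ := Nat.cast_nonneg _
    linarith
  rw [lt_div_iff₀ hrχ] at h2
  -- The truncation puts y between r^χ and r, so its logarithm to base r is an admissible a. Half of
  -- s is spared: s ≥ 2y ≥ y + D pays for the losses.
  set y := min s (2 * r) / 2 with hy
  have hy1 : r ^ χ ≤ y := by
    have h4 : r ^ χ ≤ r := by
      have := Real.rpow_le_rpow_of_exponent_le hz hχ1.le
      rwa [Real.rpow_one] at this
    have : 2 * r ^ χ ≤ min s (2 * r) := le_min h2.le (by linarith)
    linarith
  have hy2 : y ≤ r := by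
    have : min s (2 * r) ≤ 2 * r := min_le_right _ _
    linarith
  have hy3 : 2 * y ≤ s := by
    have : min s (2 * r) ≤ s := min_le_left _ _
    linarith
  have hy0 : 0 < y := by linarith
  have hy4 : ρ * s ≤ y := by
    have h5 : min 1 (2 / M) * s ≤ min s (2 * r) := by
      refine le_min ?_ ?_
      · exact mul_le_of_le_one_left hs (min_le_left _ _)
      · calc min 1 (2 / M) * s ≤ 2 / M * (M * r) :=
            mul_le_mul (min_le_right _ _) hsr hs (by positivity)
          _ = 2 * r := by field_simp
    calc ρ * s = min 1 (2 / M) * s / 2 := by rw [hρ]; ring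
      _ ≤ _ := by rw [hy]; gcongr
  set a := Real.logb r y
  have hra : r ^ a = y := Real.rpow_logb hr0 hr1.ne' hy0
  have ha1 : χ ≤ a := by rwa [← Real.rpow_le_rpow_left_iff hr1, hra]
  have ha2 : a ≤ 1 := by rwa [← Real.rpow_le_rpow_left_iff hr1, hra, Real.rpow_one]
  set K := ⌊r⌋₊
  have hK1 : (K : ℝ) ≤ r := Nat.floor_le hr0.le
  have hK2 : r < K + 1 := Nat.lt_floor_add_one r
  have hKK : K₀ ≤ K := Nat.le_floor (by linarith)
  have hDr : D ≤ r ^ χ := by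
    have : (D ^ (1 / χ)) ^ χ ≤ r ^ χ :=
      Real.rpow_le_rpow hDχ (by
        have : (0 : ℝ) ≤ K₀ := Nat.cast_nonneg _
        linarith) hχ.le
    rwa [← Real.rpow_mul hD0.le, one_div_mul_cancel hχ.ne', Real.rpow_one] at this
  have hKpos : (1 : ℝ) ≤ K := by
    have : (2 : ℝ) ≤ r := by
      have : (0 : ℝ) ≤ K₀ := Nat.cast_nonneg _
      linarith
    linarith
  have hbound : lowerTail P τ m M z s ≤ E := by
    have h4 := h K hKK a ⟨ha1, ha2⟩ z hK1 hK2
    refine le_trans (measureReal_mono fun ω hω => ?_) (h4.trans ?_)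
    · have hω' : hitTime τ z ω < M * r - s := hω
      change hitTime τ z ω < _
      have h5 : (K : ℝ) ^ a ≤ y := by
        rw [← hra]; exact Real.rpow_le_rpow (by linarith) hK1 (by linarith)
      have h6 : M * r ≤ M * (K + 1) := mul_le_mul_of_nonneg_left hK2.le hM.le
      linarith
    · rw [hE, Real.exp_le_exp]
      refine neg_le_neg ?_
      rw [hc]
      exact half_mul_div_rpow_le hr0 (by linarith) ha1 (by linarith) hθ hθ1.le hρ0.le hs
        (hy4.trans hra.ge)
  have hB1 : 1 ≤ B := by linarith
  exact hbound.trans (le_mul_of_one_le_left hE0.le hB1)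

end Concentration

/-! ### Optimising the scale K -/

section Conclusion

variable {d : ℕ} {Ω : Type*} [MeasurableSpace Ω]
  {P : Measure Ω} [IsProbabilityMeasure P] {τ : Edge d → Ω → ℝ}
  {m : Fin d → ℝ} {M : ℝ}

lemma abs_height_floorSite_sub_le (m : Fin d → ℝ) (x : EuclideanSpace ℝ (Fin d)) :
    |height m (floorSite x) - ∑ i, m i * x i| ≤ ∑ i, |m i| := by
  rw [height, ← Finset.sum_sub_distrib]
  refine (Finset.abs_sum_le_sum_abs _ _).trans (Finset.sum_le_sum fun i _ => ?_)
  rw [← mul_sub, abs_mul]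
  refine mul_le_of_le_one_right (abs_nonneg _) ?_
  have h1 := Int.floor_le (x i)
  have h2 := Int.lt_floor_add_one (x i)
  change |((⌊x i⌋ : ℤ) : ℝ) - x i| ≤ 1
  rw [abs_le]
  constructor <;> linarith

/-- The bound obtained by cutting at scale `K`, for endpoints on a multiple of the hyperplane. -/
lemma ScaleBound.exists_real_lt_le (hM : 0 < M) {κ : ℝ} (h : ScaleBound P τ m M κ) :
    ∃ c q K₁ b : ℝ, 0 < c ∧ 0 < q ∧ 2 ≤ K₁ ∧ 0 ≤ b ∧ ∀ K : ℝ, K₁ ≤ K → ∀ N : ℕ, b ≤ N →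
      ∀ v : EuclideanSpace ℝ (Fin d), ∑ i, m i * v i = 1 → ∀ s, b ≤ s →
      P.real {ω | T (fun e => τ e ω) 0 ((N : ℝ) • v) < N * M - s} ≤
        Real.exp (-(c * K ^ (-κ) * s) + q * (N / K + 1) * Real.log K) := by
  obtain ⟨c, q, K₁, hc, hq, hK₁, h⟩ := h
  set b₀ := ∑ i, |m i|
  have hb₀ : 0 ≤ b₀ := Finset.sum_nonneg fun i _ => abs_nonneg _
  -- Taking integer parts changes the height by at most b₀. Half of s pays for M b₀, whence c / 2;
  -- heights up to 2N give 2q.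
  refine ⟨c / 2, q * 2, K₁, b₀ + 2 * (M * b₀), by positivity, by positivity, hK₁, by positivity,
    fun K hK N hN v hv s hs => ?_⟩
  have hMb : 0 ≤ M * b₀ := by positivity
  have hK0 : 0 < K := by linarith
  set z := floorSite ((N : ℝ) • v) with hz
  have h1 := abs_height_floorSite_sub_le m ((N : ℝ) • v)
  have h2 : ∑ i, m i * ((N : ℝ) • v) i = N := by
    have : ∑ i, m i * ((N : ℝ) • v) i = N * ∑ i, m i * v i := by
      rw [Finset.mul_sum]
      refine Finset.sum_congr rfl fun i _ => ?_
      rw [PiLp.smul_apply, smul_eq_mul]; ring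
    rw [this, hv, mul_one]
  rw [h2, abs_le] at h1
  refine le_trans (measureReal_mono fun ω hω => ?_) ((h K hK z (by linarith) (s / 2)).trans ?_)
  · have hω' : T (fun e => τ e ω) 0 ((N : ℝ) • v) < N * M - s := hω
    rw [T_zero_eq_hitTime] at hω'
    change hitTime τ z ω < _
    have : M * (N - b₀) ≤ M * height m z := mul_le_mul_of_nonneg_left (by linarith) hM.le
    linarith
  · rw [Real.exp_le_exp]
    have hlog : 0 ≤ Real.log K := Real.log_nonneg (by linarith)
    have h3 : height m z / K + 2 ≤ 2 * (N / K + 1) := by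
      have : height m z / K ≤ 2 * N / K := by gcongr; linarith
      rw [mul_div_assoc] at this
      linarith
    have h4 := mul_le_mul_of_nonneg_right (mul_le_mul_of_nonneg_left h3 hq.le) hlog
    linarith

/-- If the leading exponent exceeds the others by a uniform gap, it dominates. -/
lemma exists_rpow_dominates {c q g : ℝ} (hc : 0 < c) (hq : 0 < q) (hg : 0 < g) :
    ∃ X : ℝ, 1 ≤ X ∧ ∀ x, X ≤ x → ∀ D E F : ℝ, E ≤ D - g → F ≤ D - g →
      x ^ E + q * x ^ F * Real.log x ≤ c * x ^ D := by
  set Y := (1 + q * (2 / g)) / c with hY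
  have hY0 : 0 < Y := by positivity
  refine ⟨max 1 (Y ^ (2 / g)), le_max_left _ _, fun x hx D E F hE hF => ?_⟩
  have hx1 : 1 ≤ x := (le_max_left _ _).trans hx
  have hx0 : 0 < x := by linarith
  have hxY : Y ≤ x ^ (g / 2) := by
    have : (Y ^ (2 / g)) ^ (g / 2) ≤ x ^ (g / 2) :=
      Real.rpow_le_rpow (by positivity) ((le_max_right _ _).trans hx) (by positivity)
    rwa [← Real.rpow_mul hY0.le, div_mul_div_cancel₀' (by norm_num) , div_self hg.ne',
      Real.rpow_one] at this
  have h1 : x ^ E ≤ x ^ (D - g / 2) := Real.rpow_le_rpow_of_exponent_le hx1 (by linarith)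
  have h2 : x ^ F * Real.log x ≤ 2 / g * x ^ (D - g / 2) := by
    have h3 : Real.log x ≤ x ^ (g / 2) / (g / 2) := Real.log_le_rpow_div hx0.le (by positivity)
    calc x ^ F * Real.log x ≤ x ^ (D - g) * (x ^ (g / 2) / (g / 2)) :=
          mul_le_mul (Real.rpow_le_rpow_of_exponent_le hx1 hF) h3 (Real.log_nonneg hx1)
            (by positivity)
      _ = 2 / g * (x ^ (D - g) * x ^ (g / 2)) := by field_simp
      _ = _ := by rw [← Real.rpow_add hx0]; ring_nf
  have h4 : x ^ D = x ^ (g / 2) * x ^ (D - g / 2) := by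
    rw [← Real.rpow_add hx0]; ring_nf
  have hp : 0 < x ^ (D - g / 2) := by positivity
  have h5 : 1 + q * (2 / g) ≤ c * x ^ (g / 2) := by
    rwa [hY, div_le_iff₀' hc] at hxY
  calc x ^ E + q * x ^ F * Real.log x ≤
        x ^ (D - g / 2) + q * (2 / g * x ^ (D - g / 2)) := by
        rw [mul_assoc]; gcongr
    _ = (1 + q * (2 / g)) * x ^ (D - g / 2) := by ring
    _ ≤ c * x ^ (g / 2) * x ^ (D - g / 2) := by gcongr
    _ = c * x ^ D := by rw [h4]; ring

/-- Lower tail with the optimal exponent, for moderate deviations. -/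
lemma moderate_deviation (hM : 0 < M) {χ : ℝ} (hχ : 0 < χ) (hχ1 : χ < 1)
    (h : ∀ κ, χ < κ → κ < 1 → ScaleBound P τ m M κ) {ε : ℝ} (hε : 0 < ε) :
    ∃ N₀ : ℕ, ∀ N : ℕ, N₀ ≤ N → ∀ a ∈ Set.Icc (χ + ε) 1, ∀ v : EuclideanSpace ℝ (Fin d),
      ∑ i, m i * v i = 1 →
      P.real {ω | T (fun e => τ e ω) 0 ((N : ℝ) • v) < (N : ℝ) * M - (N : ℝ) ^ a} ≤
        Real.exp (-((N : ℝ) ^ ((1 - ε) / (1 - χ) * (a - χ)))) := by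
  rcases le_or_gt 1 ε with hε1 | hε1
  · exact ⟨0, fun N _ a ha => absurd (ha.1.trans ha.2) (by linarith)⟩
  have hχ' : 0 < 1 - χ := by linarith
  set w := ε ^ 2 / 4 with hw
  have hw0 : 0 < w := by positivity
  have hw1 : w ≤ 1 / 4 := by rw [hw]; nlinarith
  set η := w * (1 - χ) / 4 with hη
  have hη0 : 0 < η := by positivity
  have hηw : η ≤ w / 4 := by rw [hη]; nlinarith
  have hηχ : η ≤ (1 - χ) / 4 := by rw [hη]; nlinarith
  set g := w * (1 - χ) / 2 with hg
  have hg0 : 0 < g := by positivity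
  have hgw : g ≤ w / 2 := by rw [hg]; nlinarith
  obtain ⟨c, q, K₁, b, hc, hq, hK₁, hb, hbound⟩ :=
    (h (χ + η) (by linarith) (by linarith)).exists_real_lt_le hM
  obtain ⟨X, hX1, hX⟩ := exists_rpow_dominates (c := c) (q := 4 * q) hc (by positivity) hg0
  have hK₁0 : 0 < K₁ := by linarith
  obtain ⟨N₀, hN₀⟩ := exists_nat_ge (X + K₁ ^ (1 / w) + b + b ^ (1 / ε))
  have p1 : 0 ≤ K₁ ^ (1 / w) := by positivity
  have p2 : 0 ≤ b ^ (1 / ε) := by positivity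
  refine ⟨N₀, fun N hN a ha v hv => ?_⟩
  have hNN : (N₀ : ℝ) ≤ N := by exact_mod_cast hN
  set x : ℝ := (N : ℝ) with hx
  have hx1 : 1 ≤ x := by linarith
  have hx0 : 0 < x := by linarith
  obtain ⟨ha1, ha2⟩ := ha
  -- The exponent of K that balances K^(-χ) N^a with N/K: then a - χA = 1 - A = (a - χ)/(1 - χ). The
  -- extra w tips the balance so that the gain wins by N^g, uniformly in a.
  set A := (1 - a) / (1 - χ) with hA
  have hA0 : 0 ≤ A := div_nonneg (by linarith) hχ'.le
  have hA1 : A ≤ 1 := by rw [hA, div_le_one hχ']; linarith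
  have hAχ : A * (1 - χ) = 1 - a := div_mul_cancel₀ _ hχ'.ne'
  set β := A + w with hβ
  have hKβ : K₁ ≤ x ^ β := by
    have h1 : (K₁ ^ (1 / w)) ^ w ≤ x ^ w := Real.rpow_le_rpow p1 (by linarith) hw0.le
    rw [← Real.rpow_mul hK₁0.le, one_div_mul_cancel hw0.ne', Real.rpow_one] at h1
    exact h1.trans (Real.rpow_le_rpow_of_exponent_le hx1 (by linarith))
  have hbs : b ≤ x ^ a := by
    have h1 : (b ^ (1 / ε)) ^ ε ≤ x ^ ε := Real.rpow_le_rpow p2 (by linarith) hε.le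
    rw [← Real.rpow_mul hb, one_div_mul_cancel hε.ne', Real.rpow_one] at h1
    exact h1.trans (Real.rpow_le_rpow_of_exponent_le hx1 (by linarith))
  refine (hbound (x ^ β) hKβ N (by linarith) v hv (x ^ a) hbs).trans ?_
  rw [Real.exp_le_exp, ← hx]
  have k1 : (x ^ β) ^ (-(χ + η)) * x ^ a = x ^ (a - (χ + η) * β) := by
    rw [← Real.rpow_mul hx0.le, ← Real.rpow_add hx0]; ring_nf
  have k2 : x / x ^ β = x ^ (1 - β) := by
    rw [Real.rpow_sub hx0, Real.rpow_one]
  set D := a - (χ + η) * β with hD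
  have hDE : (1 - ε) / (1 - χ) * (a - χ) ≤ D - g := by
    have e1 : (1 - ε) / (1 - χ) * (a - χ) = (1 - ε) * (1 - A) := by
      rw [hA]; field_simp; ring
    have e2 : ε * (1 - A) ≥ ε * ε := by
      refine mul_le_mul_of_nonneg_left ?_ hε.le
      rw [hA, le_sub_iff_add_le, ← le_sub_iff_add_le', div_le_iff₀ hχ']
      nlinarith
    have e3 : D = 1 - A - η * A - (χ + η) * w := by
      rw [hD, hβ]; linear_combination hAχ
    have e4 : η * A ≤ η := mul_le_of_le_one_right hη0.le hA1
    have e5 : (χ + η) * w ≤ w := mul_le_of_le_one_left hw0.le (by linarith)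
    have e6 : ε * ε = 4 * w := by rw [hw]; ring
    rw [e1, e3]
    linarith
  have hE0 : 0 ≤ (1 - ε) / (1 - χ) * (a - χ) :=
    mul_nonneg (div_nonneg (by linarith) hχ'.le) (by linarith)
  -- The maximum with 0 handles the additive 1 in N/K + 1, since K may exceed N.
  have hF : max (1 - β) 0 ≤ D - g := by
    refine max_le ?_ (hE0.trans hDE)
    have e1 : D - (1 - β) = w * (1 - χ - η) - η * A := by
      rw [hD, hβ]; linear_combination hAχ
    have e4 : η * A ≤ η := mul_le_of_le_one_right hη0.le hA1
    have e5 : w * (1 - χ - η) ≥ w * (3 * (1 - χ) / 4) :=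
      mul_le_mul_of_nonneg_left (by linarith) hw0.le
    have e6 : w * (3 * (1 - χ) / 4) - η = g := by rw [hη, hg]; ring
    linarith
  have key := hX x (by linarith) D _ _ hDE hF
  rw [Real.log_rpow hx0, k2, mul_assoc c, k1]
  have hlog : 0 ≤ Real.log x := Real.log_nonneg hx1
  have k3 : x ^ (1 - β) + 1 ≤ 2 * x ^ max (1 - β) 0 := by
    have f1 := Real.rpow_le_rpow_of_exponent_le hx1 (le_max_left (1 - β) 0)
    have f2 : 1 ≤ x ^ max (1 - β) 0 := Real.one_le_rpow hx1 (le_max_right _ _)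
    linarith
  have k4 : q * (x ^ (1 - β) + 1) * (β * Real.log x) ≤
      q * (2 * x ^ max (1 - β) 0) * (2 * Real.log x) := by
    have : β ≤ 2 := by linarith
    gcongr
  linarith

/-- Lower tail with the optimal exponent, for small large deviations. -/
lemma large_deviation (hM : 0 < M) {χ : ℝ} (hχ : 0 < χ) (hχ1 : χ < 1)
    (h : ∀ κ, χ < κ → κ < 1 → ScaleBound P τ m M κ)
    {u : EuclideanSpace ℝ (Fin d)} (hmu : ∑ i, m i * u i = 1) {ε : ℝ} (hε : 0 < ε) :
    ∃ ζ₀ : ℝ, 0 < ζ₀ ∧ ∀ ζ : ℝ, 0 < ζ → ζ < ζ₀ → ∃ N₀ : ℕ, ∀ N : ℕ, N₀ ≤ N →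
      P.real {ω | T (fun e => τ e ω) 0 ((N : ℝ) • u) < (N : ℝ) * M - ζ * (N : ℝ)} ≤
        Real.exp (-(ζ ^ ((1 + ε) * (1 / (1 - χ))) * N)) := by
  have hχ' : 0 < 1 - χ := by linarith
  set w := min (ε / 4) 1 with hw
  have hw0 : 0 < w := lt_min (by positivity) one_pos
  have hwε : w ≤ ε / 4 := min_le_left _ _
  have hw1 : w ≤ 1 := min_le_right _ _
  set η := w * (1 - χ) ^ 2 / 4 with hη
  have hη0 : 0 < η := by positivity
  set B := 1 / (1 - χ) with hB
  have hBχ : B * (1 - χ) = 1 := one_div_mul_cancel hχ'.ne'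
  have hB1 : 1 ≤ B := by rw [hB, le_div_iff₀ hχ']; linarith
  have hηB : η * B = w * (1 - χ) / 4 := by
    rw [hη]; linear_combination (w * (1 - χ) / 4) * hBχ
  have hηχ : η ≤ (1 - χ) / 4 := by
    have : w * (1 - χ) ^ 2 ≤ 1 * (1 - χ) := by
      rw [pow_two]
      refine mul_le_mul hw1 ?_ (by positivity) zero_le_one
      exact mul_le_of_le_one_left hχ'.le (by linarith)
    rw [hη]; linarith
  set g := w * (1 - χ) / 2 with hg
  have hg0 : 0 < g := by positivity
  have hgw : g ≤ w := by rw [hg]; nlinarith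
  obtain ⟨c, q, K₁, b, hc, hq, hK₁, hb, hbound⟩ :=
    (h (χ + η) (by linarith) (by linarith)).exists_real_lt_le hM
  -- With x = 1/ζ the scale is K = x^β, independent of N; β = B would balance K^(-χ) ζ with 1/K, and
  -- w again gives room.
  set β := B + w with hβ
  have hβ0 : 0 < β := by linarith
  obtain ⟨X, hX1, hX⟩ := exists_rpow_dominates (c := c) (q := 2 * q * β) hc (by positivity) hg0
  refine ⟨1 / (X + K₁), by positivity, fun ζ hζ hζ1 => ?_⟩
  set x := 1 / ζ with hx
  have hxX : X + K₁ ≤ x := by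
    rw [hx, le_div_iff₀ hζ]
    rw [lt_div_iff₀ (by positivity)] at hζ1
    linarith
  have hx1 : 1 ≤ x := by linarith
  have hx0 : 0 < x := by linarith
  have hζx : ζ = x ^ (-1 : ℝ) := by rw [Real.rpow_neg_one, hx]; simp
  have hKβ : K₁ ≤ x ^ β := by
    have : x ^ (1 : ℝ) ≤ x ^ β := Real.rpow_le_rpow_of_exponent_le hx1 (by linarith)
    rw [Real.rpow_one] at this
    linarith
  obtain ⟨N₀, hN₀⟩ := exists_nat_ge (b + b * x + x ^ β)
  refine ⟨N₀, fun N hN => ?_⟩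
  have hNN : (N₀ : ℝ) ≤ N := by exact_mod_cast hN
  have p1 : 0 ≤ b * x := by positivity
  have p2 : 0 < x ^ β := by positivity
  have hbs : b ≤ ζ * N := by
    have : b * x ≤ N := by linarith
    calc b = ζ * (b * x) := by rw [hx]; field_simp
      _ ≤ ζ * N := by gcongr
  refine (hbound (x ^ β) hKβ N (by linarith) u hmu (ζ * N) hbs).trans ?_
  rw [Real.exp_le_exp]
  set D := -((χ + η) * β + 1) with hD
  have k1 : (x ^ β) ^ (-(χ + η)) * ζ = x ^ D := by
    rw [hζx, ← Real.rpow_mul hx0.le, ← Real.rpow_add hx0, hD]; ring_nf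
  have k2 : ζ ^ ((1 + ε) * B) = x ^ (-((1 + ε) * B)) := by
    rw [hζx, ← Real.rpow_mul hx0.le]; ring_nf
  have k3 : (N : ℝ) / x ^ β + 1 ≤ 2 * (N * x ^ (-β)) := by
    have : 1 ≤ (N : ℝ) / x ^ β := by rw [le_div_iff₀ p2]; linarith
    rw [Real.rpow_neg hx0.le, ← div_eq_mul_inv]
    linarith
  have hDE : -((1 + ε) * B) ≤ D - g := by
    have e1 : (χ + η) * β + 1 = B + η * B + (χ + η) * w := by
      rw [hβ]; linear_combination -hBχ
    have e2 : (χ + η) * w ≤ w := mul_le_of_le_one_left hw0.le (by linarith)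
    have e3 : ε ≤ ε * B := le_mul_of_one_le_right hε.le hB1
    have e4 : η * B ≤ w := by rw [hηB]; nlinarith
    rw [hD]
    linarith
  have hF : -β ≤ D - g := by
    have e1 : β - ((χ + η) * β + 1) = w * (1 - χ - η) - η * B := by
      rw [hβ]; linear_combination hBχ
    have e5 : w * (1 - χ - η) ≥ w * (3 * (1 - χ) / 4) :=
      mul_le_mul_of_nonneg_left (by linarith) hw0.le
    have e6 : w * (3 * (1 - χ) / 4) - w * (1 - χ) / 4 = g := by rw [hg]; ring
    rw [hD]
    linarith
  have key := hX x (by linarith) D _ _ hDE hF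
  have hN0 : (0 : ℝ) ≤ N := Nat.cast_nonneg _
  have key' := mul_le_mul_of_nonneg_right key hN0
  have hlog : 0 ≤ Real.log x := Real.log_nonneg hx1
  rw [Real.log_rpow hx0, k2]
  have k4 : q * ((N : ℝ) / x ^ β + 1) * (β * Real.log x) ≤
      q * (2 * (N * x ^ (-β))) * (β * Real.log x) := by gcongr
  have k5 : c * (x ^ β) ^ (-(χ + η)) * (ζ * N) = c * x ^ D * N := by
    rw [← k1]; ring
  rw [k5]
  linarith

end Conclusion

/-! ### Null sets, degenerate cases and the logarithmic rate -/

section Clamp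

variable {d : ℕ} {Ω : Type*} [MeasurableSpace Ω] {P : Measure Ω} {τ : Edge d → Ω → ℝ}

/-- Bounded i.i.d. weights agree almost surely with weights that are bounded everywhere. -/
lemma IsWeightField.exists_isClampedField (hτ : IsWeightField P τ) :
    ∃ τ' : Edge d → Ω → ℝ, ∃ C : ℝ, 0 ≤ C ∧ IsClampedField P τ' C ∧
      ∀ᵐ ω ∂P, (fun e => τ e ω) = fun e => τ' e ω := by
  obtain ⟨C, hC⟩ := hτ.bounded
  set f : ℝ → ℝ := fun s => max 0 (min s (max C 0)) with hf
  have mf : Measurable f := by fun_prop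
  refine ⟨fun e ω => f (τ e ω), max C 0, le_max_right _ _, ⟨fun e => mf.comp (hτ.measurable e),
    hτ.indep.comp (fun _ => f) fun _ => mf, fun e e' => (hτ.identDistrib e e').comp mf,
    fun e ω => le_max_left _ _,
    fun e ω => max_le (le_max_right _ _) (min_le_right _ _)⟩, ?_⟩
  have h1 : ∀ᵐ ω ∂P, ∀ e, 0 ≤ τ e ω := ae_all_iff.2 hτ.nonneg
  have h2 : ∀ᵐ ω ∂P, ∀ e, τ e ω ≤ C := ae_all_iff.2 hC
  filter_upwards [h1, h2] with ω h1 h2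
  funext e
  have : τ e ω ≤ max C 0 := (h2 e).trans (le_max_left _ _)
  simp [hf, min_eq_left this, max_eq_right (h1 e)]

lemma real_T_lt_congr {τ' : Edge d → Ω → ℝ}
    (h : ∀ᵐ ω ∂P, (fun e => τ e ω) = fun e => τ' e ω) (x y : EuclideanSpace ℝ (Fin d)) (s : ℝ) :
    P.real {ω | T (fun e => τ e ω) x y < s} = P.real {ω | T (fun e => τ' e ω) x y < s} := by
  refine measureReal_congr ?_
  filter_upwards [h] with ω hω
  change (T (fun e => τ e ω) x y < s) = (T (fun e => τ' e ω) x y < s)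
  rw [hω]

/-- Concentration at a positive level forces the hyperplane to avoid the origin. -/
lemma not_concentration_at_zero [IsProbabilityMeasure P] {C : ℝ} (hτ : IsClampedField P τ C)
    {M χ θ : ℝ} (hM : 0 < M) (hχ1 : χ < 1) {K₀ : ℕ}
    (h : ∀ K : ℕ, K₀ ≤ K → ∀ a ∈ Set.Icc χ 1,
      P.real {ω | T (fun e => τ e ω) 0 ((K : ℝ) • (0 : EuclideanSpace ℝ (Fin d))) <
        (K : ℝ) * M - (K : ℝ) ^ a} ≤ Real.exp (-((K : ℝ) ^ (θ * (a - χ))))) : False := by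
  -- Any a in [χ, 1) with a ≥ 0 and a > χ serves, in fact: K^a is then negligible against K M, the
  -- event with T(0, 0) = 0 is certain, and the claimed bound is below 1.
  set a := max ((χ + 1) / 2) 0 with ha
  have ha1 : a < 1 := max_lt (by linarith) one_pos
  have haχ : χ ≤ a := le_trans (by linarith) (le_max_left _ _)
  obtain ⟨A, hA0, hA⟩ := exists_mul_rpow_le (a := a) (b := 1) (c := M / 2) (B := 1) ha1
    (le_max_right _ _) (by positivity) zero_le_one
  obtain ⟨K, hK⟩ := exists_nat_gt (K₀ + 1 + A / (M / 2))
  have hA2 : 0 ≤ A / (M / 2) := by positivity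
  have hK₀ : (0 : ℝ) ≤ K₀ := Nat.cast_nonneg _
  have hK0 : (0 : ℝ) < K := by linarith
  have hKK : K₀ ≤ K := by
    have : (K₀ : ℝ) ≤ K := by linarith
    exact_mod_cast this
  have h1 := h K hKK a ⟨haχ, ha1.le⟩
  have h2 := hA K hK0.le
  have h3 : A < K * (M / 2) := by
    rw [← div_lt_iff₀ (by positivity)]; linarith
  rw [Real.rpow_one, one_mul] at h2
  have h4 : {ω | T (fun e => τ e ω) 0 ((K : ℝ) • (0 : EuclideanSpace ℝ (Fin d))) <
      (K : ℝ) * M - (K : ℝ) ^ a} = Set.univ := by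
    refine Set.eq_univ_of_forall fun ω => ?_
    change T (fun e => τ e ω) 0 _ < _
    rw [smul_zero, T, siteTime_self fun e => hτ.nonneg e ω]
    linarith
  rw [h4, probReal_univ] at h1
  have h5 : 0 < (K : ℝ) ^ (θ * (a - χ)) := by positivity
  have h6 : Real.exp (-((K : ℝ) ^ (θ * (a - χ)))) < 1 := Real.exp_lt_one_iff.2 (by linarith)
  linarith

lemma real_T_lt_of_nonpos [IsProbabilityMeasure P] {C : ℝ} (hτ : IsClampedField P τ C)
    (x : EuclideanSpace ℝ (Fin d)) {s : ℝ} (hs : s ≤ 0) :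
    P.real {ω | T (fun e => τ e ω) 0 x < s} = 0 := by
  have : {ω | T (fun e => τ e ω) 0 x < s} = ∅ := by
    refine Set.eq_empty_of_forall_notMem fun ω hω => ?_
    have h1 : T (fun e => τ e ω) 0 x < s := hω
    rw [T_zero_eq_hitTime] at h1
    linarith [hτ.hitTime_nonneg (floorSite x) ω]
  rw [this, measureReal_empty]

/-- An eventual exponential bound gives the logarithmic rate. -/
lemma limsup_log_le [IsProbabilityMeasure P] {A : ℕ → Set Ω} {r : ℝ} {N₀ : ℕ}
    (h : ∀ N : ℕ, N₀ ≤ N → P.real (A N) ≤ Real.exp (-(r * N))) :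
    limsup (fun N : ℕ => (((N : ℝ)⁻¹ : ℝ) : EReal) * ENNReal.log (P (A N))) atTop ≤
      ((-r : ℝ) : EReal) := by
  refine limsup_le_of_le (h := ?_)
  filter_upwards [eventually_ge_atTop (max N₀ 1)] with N hN
  have hN1 : (1 : ℝ) ≤ N := by exact_mod_cast (le_max_right _ _).trans hN
  have h1 : P (A N) ≤ ENNReal.ofReal (Real.exp (-(r * N))) := by
    rw [← ofReal_measureReal]
    exact ENNReal.ofReal_le_ofReal (h N ((le_max_left _ _).trans hN))
  have h2 : ENNReal.log (P (A N)) ≤ ((-(r * N) : ℝ) : EReal) := by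
    refine (ENNReal.log_monotone h1).trans (le_of_eq ?_)
    rw [ENNReal.log_ofReal_of_pos (Real.exp_pos _), Real.log_exp]
  refine (mul_le_mul_of_nonneg_left h2 (by
    exact_mod_cast inv_nonneg.2 (by linarith : (0 : ℝ) ≤ N))).trans (le_of_eq ?_)
  rw [← EReal.coe_mul]
  congr 1
  field_simp

end Clamp

end FPP

/-! ### Assembly -/

theorem mainTheorem3 {d : ℕ} (hd : 2 ≤ d) {Ω : Type*} [MeasurableSpace Ω]
    (P : Measure Ω) [IsProbabilityMeasure P]
    (τ : FPP.Edge d → Ω → ℝ) (hτ : FPP.IsWeightField P τ)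
    (u : EuclideanSpace ℝ (Fin d)) (hu : ‖u‖ = 1)
    (H : Set (EuclideanSpace ℝ (Fin d))) (hH : FPP.IsTangentHyperplane P τ u H)
    (χ : ℝ) (hχ : χ ∈ Set.Ioo (0 : ℝ) 1)
    (hconc : FPP.LowerTailConcentration P τ u H χ) :
    (∀ ε : ℝ, 0 < ε → ∃ N₀ : ℕ, ∀ N : ℕ, N₀ ≤ N →
      ∀ a ∈ Set.Icc (χ + ε) 1, ∀ v ∈ H,
        P.real {ω | FPP.T (fun e => τ e ω) 0 ((N : ℝ) • v)
            < (N : ℝ) * FPP.timeConstant P τ u - (N : ℝ) ^ a}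
          ≤ Real.exp (-((N : ℝ) ^ ((1 - ε) / (1 - χ) * (a - χ))))) ∧
    (∀ ε : ℝ, 0 < ε → ∃ ζ₀ : ℝ, 0 < ζ₀ ∧ ∀ ζ : ℝ, 0 < ζ → ζ < ζ₀ →
      limsup (fun N : ℕ => (((N : ℝ)⁻¹ : ℝ) : EReal) *
          ENNReal.log (P {ω | FPP.T (fun e => τ e ω) 0 ((N : ℝ) • u)
            < (N : ℝ) * FPP.timeConstant P τ u - ζ * (N : ℝ)})) atTop
        ≤ ((-(ζ ^ ((1 + ε) * (1 / (1 - χ)))) : ℝ) : EReal)) := by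
  obtain ⟨n, hn, -, hHn⟩ := hH
  obtain ⟨θ₀, hθ₀, K₀, hconc⟩ := hconc
  obtain ⟨hχ0, hχ1⟩ := hχ
  obtain ⟨τ', C, hC, hτ', hae⟩ := hτ.exists_isClampedField
  have hcongr := FPP.real_T_lt_congr hae
  simp only [hcongr] at hconc ⊢
  suffices hmain : (∀ ε : ℝ, 0 < ε → ∃ N₀ : ℕ, ∀ N : ℕ, N₀ ≤ N →
      ∀ a ∈ Set.Icc (χ + ε) 1, ∀ v ∈ H,
        P.real {ω | FPP.T (fun e => τ' e ω) 0 ((N : ℝ) • v)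
            < (N : ℝ) * FPP.timeConstant P τ u - (N : ℝ) ^ a}
          ≤ Real.exp (-((N : ℝ) ^ ((1 - ε) / (1 - χ) * (a - χ))))) ∧
      (∀ ε : ℝ, 0 < ε → ∃ ζ₀ : ℝ, 0 < ζ₀ ∧ ∀ ζ : ℝ, 0 < ζ → ζ < ζ₀ → ∃ N₀ : ℕ, ∀ N : ℕ, N₀ ≤ N →
        P.real {ω | FPP.T (fun e => τ' e ω) 0 ((N : ℝ) • u)
          < (N : ℝ) * FPP.timeConstant P τ u - ζ * (N : ℝ)} ≤
        Real.exp (-(ζ ^ ((1 + ε) * (1 / (1 - χ))) * N))) by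
    refine ⟨hmain.1, fun ε hε => ?_⟩
    obtain ⟨ζ₀, hζ₀, h⟩ := hmain.2 ε hε
    refine ⟨ζ₀, hζ₀, fun ζ hζ hζ1 => ?_⟩
    obtain ⟨N₀, h⟩ := h ζ hζ hζ1
    exact FPP.limsup_log_le (N₀ := N₀) fun N hN => by rw [hcongr]; exact h N hN
  -- From here the time constant enters only as a number. If it is nonpositive, the thresholds are
  -- too, and the events are empty.
  set M := FPP.timeConstant P τ u
  rcases le_or_gt M 0 with hM | hM
  · refine ⟨fun ε hε => ⟨0, fun N _ a _ v _ => ?_⟩,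
      fun ε hε => ⟨1, one_pos, fun ζ hζ _ => ⟨0, fun N _ => ?_⟩⟩⟩
    all_goals
      have hN : (0 : ℝ) ≤ N := Nat.cast_nonneg _
      rw [FPP.real_T_lt_of_nonpos hτ']
      · exact (Real.exp_pos _).le
    · have : 0 ≤ (N : ℝ) ^ a := by positivity
      nlinarith
    · nlinarith
  have hinner (v : EuclideanSpace ℝ (Fin d)) : inner ℝ n v = ∑ i, n i * v i := by
    rw [PiLp.inner_apply]
    exact Finset.sum_congr rfl fun i _ => by simp [mul_comm]
  have hnu : inner ℝ n u ≠ 0 := by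
    intro h0
    refine FPP.not_concentration_at_zero hτ' hM hχ1 fun K hK a ha => hconc K hK a ha 0 ?_
    rw [hHn, Set.mem_ofPred_eq, h0, inner_zero_right]
  -- As the hyperplane avoids the origin, its normal can be scaled so that the hyperplane is the
  -- level set 1.
  set m : Fin d → ℝ := fun i => n i / inner ℝ n u with hm
  have hsum (v : EuclideanSpace ℝ (Fin d)) : ∑ i, m i * v i = inner ℝ n v / inner ℝ n u := by
    rw [hinner v, Finset.sum_div]
    exact Finset.sum_congr rfl fun i _ => by rw [hm]; ring
  have hmem (v : EuclideanSpace ℝ (Fin d)) : v ∈ H ↔ ∑ i, m i * v i = 1 := by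
    rw [hsum, div_eq_one_iff_eq hnu, hHn, Set.mem_ofPred_eq]
  have hmu : ∑ i, m i * u i = 1 := by rw [hsum, div_self hnu]
  obtain ⟨i, hi⟩ : ∃ i, m i ≠ 0 := by
    by_contra! h0
    simp [h0] at hmu
  -- The interpolation between s^θ and s needs θ < 1; lowering θ only weakens the concentration.
  set θ := min θ₀ (1 / 2)
  have hconc₀ : FPP.HyperplaneConcentration P τ' m M χ θ₀ :=
    ⟨K₀, fun K hK a ha v hv => hconc K hK a ha v ((hmem v).2 hv)⟩
  have hθ : 0 < θ := lt_min hθ₀ (by norm_num)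
  have hθ1 : θ < 1 := (min_le_right _ _).trans_lt (by norm_num)
  have hS := (hconc₀.mono (min_le_left _ _)).stretchedTailBound hτ' hC hM hu hmu hχ0 hχ1 hθ hθ1
  have hscale : ∀ κ, χ < κ → κ < 1 → FPP.ScaleBound P τ' m M κ := fun κ h1 h2 =>
    hS.scaleBound hτ' hM hi hχ0 hχ1 hθ hθ1 h1 h2
  refine ⟨fun ε hε => ?_, fun ε hε => FPP.large_deviation hM hχ0 hχ1 hscale hmu hε⟩
  obtain ⟨N₀, h⟩ := FPP.moderate_deviation hM hχ0 hχ1 hscale hε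
  exact ⟨N₀, fun N hN a ha v hv => h N hN a ha v ((hmem v).1 hv)⟩
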